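/- Consider probability distributions over $\Sigma^n$, where $\Sigma$ is a finite non-empty alphabet and $n\ge 1$, with total variation distance $d_{\mathrm{TV}}(P,Q)=\frac12\sum_{x\in\Sigma^n}|P(x)-Q(x)|$. A distribution $P$ of $X=(X_1,\dots,X_n)\in\Sigma^n$ is a Bayesian network on a directed acyclic graph (DAG) $G$ with vertex set $[n]$ if, for every $i\in[n]$, $X_i$ is conditionally independent of $X_{\mathrm{non\text{-}descendants}(i)}$ given $X_{\mathrm{parents}(i)}$. A distance approximation algorithm for two families $(\mathcal D_1,\mathcal D_2)$ of distributions over $\Sigma^n$ is a randomized algorithm that takes as input $\epsilon\in(0,1)$ and sample access to two unknown distributions $P\in\mathcal D_1$, $Q\in\mathcal D_2$, and returns a value $\gamma\in[0,1]$ such that, with probability at least $2/3$, $\gamma-\epsilon\le d_{\mathrm{TV}}(P,Q)\le\gamma+\epsilon$. **Theorem.** Let $G_1$ and $G_2$ be two known DAGs on $n$ vertices with in-degree at most $d$, and let $\mathcal D_1$ and $\mathcal D_2$ be the families of Bayesian networks over the alphabet $\Sigma$ on $G_1$ and $G_2$ respectively. Then there is a distance approximation algorithm for $(\mathcal D_1,\mathcal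 D_2)$ that gets $m=\tilde O(|\Sigma|^{d+1}n\,\epsilon^{-2})$ samples and runs in $O(|\Sigma|^{d+1}mn)$ time. Here the algorithm is one single program for a randomized real RAM (unit-cost addition, subtraction and comparison of natural numbers, indirect addressing by natural numbers, unit-cost $+,-,\times,\div$ and comparison of real numbers, no rounding, fair coin flips; drawing a sample of $n$ symbols costs $n+1$ steps), which receives $n$, $|\Sigma|$, $d$, the adjacency matrices of $G_1$ and $G_2$, and $\epsilon$ as input, with $\Sigma$ encoded as $\{0,\dots,|\Sigma|-1\}$. The number $m$ is the total number of samples drawn from $P$ and $Q$ and depends only on $n,|\Sigma|,d,\epsilon$. The bounds hold in every run, with absolute constants $C,k$: $m\le C\,|\Sigma|^{d+1}n\,\epsilon^{-2}\,\bigl(1+\log(|\Sigma|^{d+1}n)\bigr)^k$ and the running time is at most $C\,|\Sigma|^{d+1}mn$. -/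

import Mathlib

open MeasureTheory

/-! ### Distributions over `Σ ^ n` with `Σ = {0, …, q - 1}` -/

/-- Total variation distance of two distributions on a finite set. -/
noncomputable def tvDist {α : Type*} [Fintype α] (P Q : PMF α) : ℝ :=
  (1 / 2) * ∑ x, |(P x).toReal - (Q x).toReal|

open Classical in
/-- The probability of an event under a distribution on a finite set. -/
noncomputable def pr {α : Type*} [Fintype α] (P : PMF α) (E : Set α) : ℝ :=
  ∑ x, if x ∈ E then (P x).toReal else 0

/-- The conditional probability of `A` given `C`. -/
noncomputable def condPr {α : Type*} [Fintype α] (P : PMF α) (A C : Set α) : ℝ :=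
  pr P (A ∩ C) / pr P C

/-- The event `X_S = x_S`. -/
def agree {n q : ℕ} (S : Set (Fin n)) (x : Fin n → Fin q) : Set (Fin n → Fin q) :=
  {y | ∀ j ∈ S, y j = x j}

/-- `X_A` and `X_B` are conditionally independent given `X_C`, when `X` has law `P`. -/
def CondIndepGiven {n q : ℕ} (P : PMF (Fin n → Fin q)) (A B C : Set (Fin n)) : Prop :=
  ∀ x : Fin n → Fin q, pr P (agree C x) ≠ 0 →
    condPr P (agree A x ∩ agree B x) (agree C x) =
      condPr P (agree A x) (agree C x) * condPr P (agree B x) (agree C x)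

/-! ### Directed acyclic graphs and Bayesian networks -/

def IsDAG {V : Type*} (G : Digraph V) : Prop :=
  ∀ i, ¬ Relation.TransGen G.Adj i i

def parents {V : Type*} (G : Digraph V) (i : V) : Set V :=
  {j | G.Adj j i}

/-- The vertices other than `i` that cannot be reached from `i` by a directed path. -/
def nonDescendants {V : Type*} (G : Digraph V) (i : V) : Set V :=
  {j | j ≠ i ∧ ¬ Relation.TransGen G.Adj i j}

def InDegreeLE {V : Type*} (G : Digraph V) (d : ℕ) : Prop :=
  ∀ i, (parents G i).encard ≤ d

/-- The family of the Bayesian networks on `G` over the alphabet `Fin q`. -/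
def bayesNets {n : ℕ} (q : ℕ) (G : Digraph (Fin n)) : Set (PMF (Fin n → Fin q)) :=
  {P | ∀ i, CondIndepGiven P {i} (nonDescendants G i) (parents G i)}

/-! ### A randomized real RAM with sample access to two distributions

The machine has registers and (finitely many, per program) infinite arrays that hold natural
numbers, and registers and arrays that hold real numbers.  Natural numbers can be added, subtracted
and compared and are the only addresses; real numbers can be added, subtracted, multiplied, divided
and compared.  There is no rounding from reals to naturals and no real constant in a program. -/

namespace RealRAM

/-- Elementary instructions.  The arguments are names of registers and arrays, except the second
argument of `const`, which is a literal. -/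
inductive Op where
  /-- `x_r := c` -/
  | const (r c : ℕ)
  /-- `x_r := x_a + x_b` -/
  | add (r a b : ℕ)
  /-- `x_r := max (x_a - x_b) 0` -/
  | sub (r a b : ℕ)
  /-- `x_r := A[x_i]` -/
  | load (r A i : ℕ)
  /-- `A[x_i] := x_a` -/
  | store (A i a : ℕ)
  /-- `y_r := x_a`, from natural numbers to reals -/
  | cast (r a : ℕ)
  /-- `y_r := y_a + y_b` -/
  | radd (r a b : ℕ)
  /-- `y_r := y_a - y_b` -/
  | rsub (r a b : ℕ)
  /-- `y_r := y_a * y_b` -/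
  | rmul (r a b : ℕ)
  /-- `y_r := y_a / y_b`, where division by zero gives zero -/
  | rdiv (r a b : ℕ)
  /-- `y_r := B[x_i]`, for an array `B` of reals -/
  | rload (r B i : ℕ)
  /-- `B[x_i] := y_a`, for an array `B` of reals -/
  | rstore (B i a : ℕ)
  /-- `x_r :=` a fresh fair random bit -/
  | flip (r : ℕ)
  /-- write the `n` symbols of a fresh sample into `A[0], …, A[n - 1]`; the sample is from the first
  distribution if `side` is `false` and from the second one if `side` is `true` -/
  | draw (side : Bool) (A : ℕ)

inductive Test where
  /-- `x_a < x_b` -/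
  | lt (a b : ℕ)
  /-- `y_a < y_b` -/
  | rlt (a b : ℕ)

/-- Programs. -/
inductive Cmd where
  | op (o : Op)
  | seq (c₁ c₂ : Cmd)
  /-- if `t` then `c₁` else `c₂` -/
  | branch (t : Test) (c₁ c₂ : Cmd)
  /-- while `t` do `c` -/
  | loop (t : Test) (c : Cmd)

structure State where
  /-- registers of natural numbers -/
  nreg : ℕ → ℕ
  /-- arrays of natural numbers -/
  narr : ℕ → ℕ → ℕ
  /-- registers of reals -/
  rreg : ℕ → ℝ
  /-- arrays of reals -/
  rarr : ℕ → ℕ → ℝ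
  /-- number of samples drawn so far from the two distributions -/
  draws : Bool → ℕ
  /-- number of random bits used so far -/
  flips : ℕ
  /-- number of steps made so far -/
  time : ℕ

/-- What the environment supplies: the successive samples from the first and from the second
distribution, and the successive random bits. -/
abbrev Tape (n q : ℕ) : Type :=
  (ℕ → Fin n → Fin q) × (ℕ → Fin n → Fin q) × (ℕ → Bool)

/-- The `k`-th sample from one of the two distributions. -/
def Tape.sample {n q : ℕ} (ω : Tape n q) (side : Bool) (k : ℕ) : Fin n → Fin q :=
  if side then ω.2.1 k else ω.1 k

def State.setN (s : State) (r v : ℕ) : State :=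
  { s with nreg := Function.update s.nreg r v }

noncomputable def State.setR (s : State) (r : ℕ) (v : ℝ) : State :=
  { s with rreg := Function.update s.rreg r v }

def State.tick (s : State) (t : ℕ) : State :=
  { s with time := s.time + t }

/-- The effect of an instruction on the state, apart from the step count. -/
noncomputable def Op.effect {n q : ℕ} (ω : Tape n q) (s : State) : Op → State
  | .const r c => s.setN r c
  | .add r a b => s.setN r (s.nreg a + s.nreg b)
  | .sub r a b => s.setN r (s.nreg a - s.nreg b)
  | .load r A i => s.setN r (s.narr A (s.nreg i))
  | .store A i a =>
      { s with
        narr := Function.update s.narr A (Function.update (s.narr A) (s.nreg i) (s.nreg a)) }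
  | .cast r a => s.setR r (s.nreg a : ℝ)
  | .radd r a b => s.setR r (s.rreg a + s.rreg b)
  | .rsub r a b => s.setR r (s.rreg a - s.rreg b)
  | .rmul r a b => s.setR r (s.rreg a * s.rreg b)
  | .rdiv r a b => s.setR r (s.rreg a / s.rreg b)
  | .rload r B i => s.setR r (s.rarr B (s.nreg i))
  | .rstore B i a =>
      { s with
        rarr := Function.update s.rarr B (Function.update (s.rarr B) (s.nreg i) (s.rreg a)) }
  | .flip r => { s.setN r (if ω.2.2 s.flips then 1 else 0) with flips := s.flips + 1 }
  | .draw side A =>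
      { s with
        narr := Function.update s.narr A (fun k =>
          if h : k < n then (ω.sample side (s.draws side) ⟨k, h⟩ : ℕ) else s.narr A k)
        draws := Function.update s.draws side (s.draws side + 1) }

/-- The number of steps of an instruction: drawing a sample of `n` symbols costs `n + 1` steps,
every other instruction one step. -/
def Op.cost (n : ℕ) : Op → ℕ
  | .draw _ _ => n + 1
  | _ => 1

def Test.holds (s : State) : Test → Prop
  | .lt a b => s.nreg a < s.nreg b
  | .rlt a b => s.rreg a < s.rreg b

/-- `Exec ω c s s'`: started in state `s` with tapes `ω`, the program `c` halts in state `s'`.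
Every evaluation of a test costs one step. -/
inductive Exec {n q : ℕ} (ω : Tape n q) : Cmd → State → State → Prop
  | op (o : Op) (s : State) : Exec ω (.op o) s ((o.effect ω s).tick (o.cost n))
  | seq {c₁ c₂ : Cmd} {s s' s'' : State} :
      Exec ω c₁ s s' → Exec ω c₂ s' s'' → Exec ω (.seq c₁ c₂) s s''
  | branch_true {t : Test} {c₁ c₂ : Cmd} {s s' : State} :
      t.holds s → Exec ω c₁ (s.tick 1) s' → Exec ω (.branch t c₁ c₂) s s'
  | branch_false {t : Test} {c₁ c₂ : Cmd} {s s' : State} :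
      ¬ t.holds s → Exec ω c₂ (s.tick 1) s' → Exec ω (.branch t c₁ c₂) s s'
  | loop_true {t : Test} {c : Cmd} {s s' s'' : State} :
      t.holds s → Exec ω c (s.tick 1) s' → Exec ω (.loop t c) s' s'' → Exec ω (.loop t c) s s''
  | loop_false {t : Test} {c : Cmd} {s : State} :
      ¬ t.holds s → Exec ω (.loop t c) s (s.tick 1)

/-- Executions are deterministic once the tapes are fixed. -/
theorem Exec.unique {n q : ℕ} {ω : Tape n q} {c : Cmd} {s s₁ s₂ : State}
    (h₁ : Exec ω c s s₁) (h₂ : Exec ω c s s₂) : s₁ = s₂ := by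
  induction h₁ generalizing s₂ with
  | op o s => cases h₂; rfl
  | seq _ _ ih₁ ih₂ =>
    cases h₂ with
    | seq a b => cases ih₁ a; exact ih₂ b
  | branch_true ht _ ih =>
    cases h₂ with
    | branch_true _ b => exact ih b
    | branch_false hf _ => exact absurd ht hf
  | branch_false ht _ ih =>
    cases h₂ with
    | branch_true hf _ => exact absurd hf ht
    | branch_false _ b => exact ih b
  | loop_true ht _ _ ih₁ ih₂ =>
    cases h₂ with
    | loop_true _ a b => cases ih₁ a; exact ih₂ b
    | loop_false hf => exact absurd ht hf
  | loop_false ht =>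
    cases h₂ with
    | loop_true hf _ _ => exact absurd hf ht
    | loop_false _ => rfl

/-- The law of the tapes: independent samples from `P`, independent samples from `Q` and independent
fair bits, all independent of each other. -/
noncomputable def tapeLaw {n q : ℕ} (P Q : PMF (Fin n → Fin q)) : Measure (Tape n q) :=
  (Measure.infinitePi fun _ : ℕ => P.toMeasure).prod
    ((Measure.infinitePi fun _ : ℕ => Q.toMeasure).prod
      (Measure.infinitePi fun _ : ℕ => (PMF.uniformOfFintype Bool).toMeasure))

open Classical in
/-- The adjacency matrix of `G`, row by row: cell `i * n + j` holds `1` if there is an edge from `i`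
to `j`, and `0` otherwise. -/
noncomputable def adjCells {n : ℕ} (G : Digraph (Fin n)) (k : ℕ) : ℕ :=
  if ∃ i j : Fin n, k = i * n + j ∧ G.Adj i j then 1 else 0

/-- The initial state: the natural registers `0, 1, 2` hold `n`, `q` and `d`, the arrays `0` and `1`
of naturals hold the two graphs, the real register `0` holds `ε`, and all else is zero. -/
noncomputable def input {n : ℕ} (q d : ℕ) (G₁ G₂ : Digraph (Fin n)) (ε : ℝ) : State where
  nreg := fun r => if r = 0 then n else if r = 1 then q else if r = 2 then d else 0
  narr := fun A k => if A = 0 then adjCells G₁ k else if A = 1 then adjCells G₂ k else 0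
  rreg := fun r => if r = 0 then ε else 0
  rarr := fun _ _ => 0
  draws := fun _ => 0
  flips := 0
  time := 0

/-- The output: the final content of the real register `0`. -/
def State.output (s : State) : ℝ := s.rreg 0

/-- The program `c`, started in state `start ε` for the accuracy `ε ∈ (0, 1)`, is a distance
approximation algorithm for `(D₁, D₂)`: it always halts with an output in `[0, 1]`, and with
probability at least `2 / 3` the output is within `ε` of the distance of the two distributions. -/
def IsDistanceApproximation {n q : ℕ} (c : Cmd) (start : ℝ → State)
    (D₁ D₂ : Set (PMF (Fin n → Fin q))) : Prop :=
  ∀ ε : ℝ, 0 < ε → ε < 1 →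
    (∀ ω : Tape n q, ∃ s, Exec ω c (start ε) s ∧ 0 ≤ s.output ∧ s.output ≤ 1) ∧
    ∀ P ∈ D₁, ∀ Q ∈ D₂,
      2 / 3 ≤ tapeLaw P Q {ω | ∃ s, Exec ω c (start ε) s ∧
        s.output - ε ≤ tvDist P Q ∧ tvDist P Q ≤ s.output + ε}

end RealRAM

/-! Estimator. Replace every conditional probability of the two networks by its Laplace-smoothed
frequency, (count of node and parents + 1) / (count of parents + q). The products of these factors
are strictly positive distributions p and r. Since the total variation distance of p and r is the
p-expectation of max(0, 1 - r/p), a function with values in [0, 1], it is estimated by averaging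
that function over fresh samples from P. Using P instead of p costs at most twice the distance of P
and p. No topological order is ever computed: evaluating p and r at a point only needs products of
local factors.

Accuracy. The squared distance of P and p is at most their relative entropy, which splits over the
nodes because P factorizes (`bayesNets_factor`). With log t ≤ t - 1 it is bounded by `excess`, whose
expectation only involves inverse moments of counts. Exchangeability of the samples evaluates these
(`iidE_inv_hits_le`, `iidE_inv_laplace_le`), and summing over at most q^d parent configurations for
each of the n nodes gives q^(d+1) n / (m + 1) (`iidE_excess_le`). Adding the variance of the
average, the mean square error is at most 33 q^(d+1) n / m (`iidE_sq_tvEstimate_sub_le`). Markov's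
inequality then gives confidence 2/3 with m = ⌈100 q^(d+1) n / ε²⌉ samples in each of three phases.
Because only an expectation is controlled, there is no union bound and no logarithm.

Running time. Each node owns a block of q^(d+1) counters, addressed by the base-q code of the
observed values, so a sample is processed in O(n (d + 1)) steps. The machine lacks products of
naturals and rounding: multiplication by q is a table lookup, and a real is turned into a natural by
counting up to it. The preprocessing takes O(q^(d+1) + n² + m + d) steps, which is absorbed since
q^(d+1) n ≤ m. For q ≥ 2 one has d < q^(d+1); the case q = 1, where this fails, is trivial and
treated apart. Correctness of the program is proved with loop invariants for `Runs` and the frame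
conditions `Keeps`. -/

/-! ### Expectations over independent samples -/

section Iid

variable {α : Type*}

open Classical in
/-- The number of samples in an event. -/
noncomputable def hits {m : ℕ} (E : Set α) (x : Fin m → α) : ℝ :=
  ∑ i, if x i ∈ E then 1 else 0

theorem hits_nonneg {m : ℕ} (E : Set α) (x : Fin m → α) : 0 ≤ hits E x :=
  Finset.sum_nonneg fun i _ => by split_ifs <;> norm_num

open Classical in
theorem hits_insertNth {m : ℕ} (E : Set α) (i : Fin (m + 1)) (a : α) (x : Fin m → α) :
    hits E (i.insertNth a x : Fin (m + 1) → α) = (if a ∈ E then 1 else 0) + hits E x := by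
  simp [hits, Fin.sum_univ_succAbove _ i]

theorem hits_add_hits_diff {E F : Set α} (h : E ⊆ F) {m : ℕ} (x : Fin m → α) :
    hits E x + hits (F \ E) x = hits F x := by
  classical
  simp only [hits, ← Finset.sum_add_distrib]
  refine Finset.sum_congr rfl fun i _ => ?_
  by_cases ha : x i ∈ E
  · simp [ha, h ha]
  · simp [ha]

variable [Fintype α]

/-- The expectation of `F` over `m` independent samples with weights `p`. -/
noncomputable def iidE (p : α → ℝ) (m : ℕ) (F : (Fin m → α) → ℝ) : ℝ :=
  ∑ x : Fin m → α, (∏ i, p (x i)) * F x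

/-- Any coordinate `i`, not only the first, may be isolated. This is the exchangeability on which
the bounds for inverse counts rest. -/
theorem iidE_insertNth (p : α → ℝ) {m : ℕ} (i : Fin (m + 1)) (F : (Fin (m + 1) → α) → ℝ) :
    iidE p (m + 1) F = ∑ a, p a * iidE p m fun x => F (i.insertNth a x) := by
  unfold iidE
  rw [← (Fin.insertNthEquiv (fun _ => α) i).sum_comp, Fintype.sum_prod_type]
  refine Finset.sum_congr rfl fun a _ => ?_
  rw [Finset.mul_sum]
  refine Finset.sum_congr rfl fun x _ => ?_
  rw [Fin.prod_univ_succAbove _ i]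
  simp [Fin.insertNthEquiv, mul_assoc]

theorem iidE_mono {p : α → ℝ} (hp : ∀ a, 0 ≤ p a) {m : ℕ} {F F' : (Fin m → α) → ℝ}
    (h : ∀ x, F x ≤ F' x) : iidE p m F ≤ iidE p m F' :=
  Finset.sum_le_sum fun x _ =>
    mul_le_mul_of_nonneg_left (h x) (Finset.prod_nonneg fun i _ => hp (x i))

theorem iidE_add (p : α → ℝ) {m : ℕ} (F F' : (Fin m → α) → ℝ) :
    iidE p m (fun x => F x + F' x) = iidE p m F + iidE p m F' := by
  simp [iidE, mul_add, Finset.sum_add_distrib]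

theorem iidE_const_mul (p : α → ℝ) {m : ℕ} (c : ℝ) (F : (Fin m → α) → ℝ) :
    iidE p m (fun x => c * F x) = c * iidE p m F := by
  simp only [iidE, Finset.mul_sum]
  exact Finset.sum_congr rfl fun x _ => by ring

theorem iidE_sum (p : α → ℝ) {m : ℕ} {κ : Type*} (s : Finset κ) (F : κ → (Fin m → α) → ℝ) :
    iidE p m (fun x => ∑ k ∈ s, F k x) = ∑ k ∈ s, iidE p m (F k) := by
  simp only [iidE, Finset.mul_sum]
  exact Finset.sum_comm

theorem iidE_const {p : α → ℝ} (hp : ∑ a, p a = 1) (m : ℕ) (c : ℝ) :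
    iidE p m (fun _ => c) = c := by
  induction m with
  | zero => simp [iidE]
  | succ m ih => rw [iidE_insertNth p 0]; simp only [ih]; rw [← Finset.sum_mul, hp, one_mul]

/-! ### Inverse moments of sample counts. -/

open Classical in
/-- The weight of an event. -/
noncomputable def wt (p : α → ℝ) (E : Set α) : ℝ := ∑ a, if a ∈ E then p a else 0

theorem wt_nonneg {p : α → ℝ} (hp : ∀ a, 0 ≤ p a) (E : Set α) : 0 ≤ wt p E :=
  Finset.sum_nonneg fun a _ => by split_ifs <;> simp [hp]

/-- Among m + 1 samples, let each one lying in `E` receive the share 1 / (number of samples in `E`).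
The shares add up to 1, or to 0 = 0 / 0 if `E` is missed. By exchangeability all expected shares are
equal, and isolating one sample leaves 1 / (hits + 1) over the other m. -/
theorem iidE_inv_hits_le {p : α → ℝ} (hp : ∀ a, 0 ≤ p a) (h1 : ∑ a, p a = 1) (E : Set α)
    (m : ℕ) : (m + 1) * (wt p E * iidE p m fun x => 1 / (hits E x + 1)) ≤ 1 := by
  classical
  calc (m + 1) * (wt p E * iidE p m fun x => 1 / (hits E x + 1))
      = ∑ i : Fin (m + 1), iidE p (m + 1) fun x => (if x i ∈ E then 1 else 0) / hits E x := by
        have : ∀ i : Fin (m + 1), (iidE p (m + 1) fun x => (if x i ∈ E then 1 else 0) / hits E x)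
            = wt p E * iidE p m fun x => 1 / (hits E x + 1) := fun i => by
          rw [iidE_insertNth p i, wt, Finset.sum_mul]
          refine Finset.sum_congr rfl fun a _ => ?_
          by_cases ha : a ∈ E
          · simp [hits_insertNth, ha, add_comm]
          · simp [ha, iidE]
        simp [this]
    _ = iidE p (m + 1) fun x => hits E x / hits E x := by
        rw [← iidE_sum]
        simp only [hits, Finset.sum_div]
    _ ≤ iidE p (m + 1) fun _ => 1 := iidE_mono hp fun x => div_self_le_one _
    _ = 1 := iidE_const h1 _ _

/-- Isolate each sample counted in the numerator: being in `F` it is not in `E`, so the denominator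
depends on the other samples only, and `iidE_inv_hits_le` applies to these. -/
theorem iidE_hits_div_hits_le {p : α → ℝ} (hp : ∀ a, 0 ≤ p a) (h1 : ∑ a, p a = 1)
    {E F : Set α} (hEF : Disjoint E F) (m : ℕ) :
    wt p E * iidE p m (fun x => hits F x / (hits E x + 1)) ≤ wt p F := by
  classical
  cases m with
  | zero => simpa [hits, iidE] using wt_nonneg hp F
  | succ m =>
    have : ∀ i : Fin (m + 1),
        (iidE p (m + 1) fun x => (if x i ∈ F then 1 else 0) / (hits E x + 1))
          = wt p F * iidE p m fun x => 1 / (hits E x + 1) := fun i => by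
      rw [iidE_insertNth p i, wt, Finset.sum_mul]
      refine Finset.sum_congr rfl fun a _ => ?_
      by_cases ha : a ∈ F
      · have : a ∉ E := fun h => Set.disjoint_left.1 hEF h ha
        simp [hits_insertNth, ha, this]
      · simp [ha, iidE]
    have h2 : (iidE p (m + 1) fun x => hits F x / (hits E x + 1))
        = (m + 1) * (wt p F * iidE p m fun x => 1 / (hits E x + 1)) := by
      have : (iidE p (m + 1) fun x => hits F x / (hits E x + 1)) = iidE p (m + 1)
          fun x => ∑ i : Fin (m + 1), (if x i ∈ F then 1 else 0) / (hits E x + 1) := by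
        simp only [hits, Finset.sum_div]
      rw [this, iidE_sum]
      simp [*]
    rw [h2]
    calc _ = wt p F * ((m + 1) * (wt p E * iidE p m fun x => 1 / (hits E x + 1))) := by ring
      _ ≤ wt p F * 1 :=
        mul_le_mul_of_nonneg_left (iidE_inv_hits_le hp h1 E m) (wt_nonneg hp F)
      _ = _ := mul_one _

theorem wt_add_wt_diff (p : α → ℝ) {E F : Set α} (h : E ⊆ F) :
    wt p E + wt p (F \ E) = wt p F := by
  classical
  simp only [wt, ← Finset.sum_add_distrib]
  refine Finset.sum_congr rfl fun a _ => ?_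
  by_cases ha : a ∈ E
  · simp [ha, h ha]
  · simp [ha]

/-- The inverse of the Laplace estimator of `wt p E / wt p F` is biased upwards by little. -/
theorem iidE_inv_laplace_le {p : α → ℝ} (hp : ∀ a, 0 ≤ p a) (h1 : ∑ a, p a = 1)
    {E F : Set α} (h : E ⊆ F) {q : ℝ} (hq : 1 ≤ q) (m : ℕ) :
    wt p E * iidE p m (fun x => (hits F x + q) / (hits E x + 1)) ≤
      wt p F + (q - 1) / (m + 1) := by
  -- Splitting the count of `F` into those of `E` and `F \ E`, the ratio is 1 + hits (F \ E) / (hits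
  -- E + 1) + (q - 1) / (hits E + 1).
  have h3 : (iidE p m fun x => (hits F x + q) / (hits E x + 1)) =
      (iidE p m fun _ => 1) + (iidE p m fun x => hits (F \ E) x / (hits E x + 1)) +
        (q - 1) * iidE p m fun x => 1 / (hits E x + 1) := by
    rw [← iidE_const_mul, ← iidE_add, ← iidE_add]
    congr 1
    funext x
    have := hits_nonneg E x
    rw [← hits_add_hits_diff h x]
    field_simp
    ring
  have h4 : wt p E * (iidE p m fun x => 1 / (hits E x + 1)) ≤ 1 / (m + 1) := by
    rw [le_div_iff₀ (by positivity), mul_comm]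
    exact iidE_inv_hits_le hp h1 E m
  have h5 := iidE_hits_div_hits_le hp h1 (Set.disjoint_sdiff_right (s := E) (t := F)) m
  have h6 := wt_add_wt_diff p h
  have h7 : (q - 1) / ((m : ℝ) + 1) = (q - 1) * (1 / (m + 1)) := by ring
  rw [h3, h7, iidE_const h1]
  nlinarith [mul_le_mul_of_nonneg_left h4 (sub_nonneg.2 hq)]

/-- The variance of a sum of independent centred variables with values in `[-1, 1]`. -/
theorem iidE_sq_sum_le {p : α → ℝ} (hp : ∀ a, 0 ≤ p a) (h1 : ∑ a, p a = 1) {g : α → ℝ}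
    (hg : ∑ a, p a * g a = 0) (hg1 : ∀ a, |g a| ≤ 1) (m : ℕ) :
    iidE p m (fun x => (∑ i, g (x i)) ^ 2) ≤ m := by
  induction m with
  | zero => simp [iidE]
  | succ m ih =>
    rw [iidE_insertNth p 0]
    have h2 : ∀ a, (iidE p m fun x => (∑ i, g ((Fin.insertNth 0 a x : Fin (m + 1) → α) i)) ^ 2)
        = g a ^ 2 + 2 * (iidE p m fun x => ∑ i, g (x i)) * g a
          + iidE p m fun x => (∑ i, g (x i)) ^ 2 := fun a => by
      rw [← iidE_const h1 m (g a ^ 2), ← iidE_const_mul, mul_comm _ (g a), ← iidE_const_mul,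
        ← iidE_add, ← iidE_add]
      congr 1
      funext x
      simp [Fin.sum_univ_succ]
      ring
    simp only [h2, mul_add, Finset.sum_add_distrib]
    have h3 : ∑ a, p a * g a ^ 2 ≤ 1 := by
      rw [← h1]
      refine Finset.sum_le_sum fun a _ => mul_le_of_le_one_right (hp a) ?_
      rw [← sq_abs]
      exact pow_le_one₀ (abs_nonneg _) (hg1 a)
    have h4 : ∑ a, p a * (2 * (iidE p m fun x => ∑ i, g (x i)) * g a) = 0 := by
      rw [← mul_zero (2 * (iidE p m fun x => ∑ i, g (x i))), ← hg, Finset.mul_sum]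
      exact Finset.sum_congr rfl fun a _ => by ring
    rw [h4, ← Finset.sum_mul, h1]
    push_cast
    linarith

/-- A weight summed against the inverse weights of its level sets. -/
theorem sum_div_wt_fiber_le (p : α → ℝ) {β : Type*} [Fintype β]
    (g : α → β) : ∑ a, p a / wt p {b | g b = g a} ≤ Fintype.card β := by
  classical
  rw [← Finset.sum_fiberwise_of_maps_to (t := Finset.univ) (g := g) (fun _ _ => Finset.mem_univ _),
    ← Finset.card_univ, Finset.card_eq_sum_ones, Nat.cast_sum]
  refine Finset.sum_le_sum fun c _ => ?_
  -- On a level set the denominator is constant, so the terms add up to w / w, which is 1, or 0 if w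
  -- = 0.
  have : ∑ a with g a = c, p a / wt p {b | g b = g a} = wt p {b | g b = c} / wt p {b | g b = c} := by
    conv_rhs => enter [1]; rw [wt]
    simp only [Set.mem_ofPred_eq]
    rw [← Finset.sum_filter, Finset.sum_div]
    refine Finset.sum_congr rfl fun a ha => ?_
    rw [(Finset.mem_filter.1 ha).2]
  rw [this]
  simpa using div_self_le_one _

end Iid

/-! ### Bayesian networks -/

/-- Vertices are added in a topological order. Among the sets closed under parents that satisfy `p`,
take a maximal one; a vertex outside it that is minimal for reachability has all its parents inside,
so it could be added. Closedness also shows that no earlier vertex descends from the new one, which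
the Markov property requires. -/
theorem IsDAG.induction {V : Type*} [Fintype V] [DecidableEq V] {G : Digraph V} (hG : IsDAG G)
    {p : Finset V → Prop} (h0 : p ∅)
    (hs : ∀ (S : Finset V) (i), i ∉ S → parents G i ⊆ S → (∀ j ∈ S, ¬ Relation.TransGen G.Adj i j) → p S →
      p (insert i S)) : p Finset.univ := by
  classical
  obtain ⟨S, ⟨hS, hpS⟩, hmax⟩ := (Set.toFinite
    {S : Finset V | (∀ i ∈ S, parents G i ⊆ S) ∧ p S}).exists_maximal ⟨∅, by simp, h0⟩
  by_cases hSu : S = Finset.univ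
  · exact hSu ▸ hpS
  exfalso
  have : Std.Irrefl (Relation.TransGen G.Adj) := ⟨hG⟩
  have hwf : WellFounded (Relation.TransGen G.Adj) := Finite.wellFounded_of_trans_of_irrefl _
  obtain ⟨i0, hi0⟩ : ∃ i, i ∉ S := by
    by_contra! h
    exact hSu (Finset.eq_univ_iff_forall.2 h)
  obtain ⟨i, hi, hmin⟩ := hwf.has_min {i | i ∉ S} ⟨i0, hi0⟩
  have hpar : parents G i ⊆ S := fun j hj => by
    by_contra h
    exact hmin j h (.single hj)
  have hclosed : ∀ j k, Relation.TransGen G.Adj j k → k ∈ S → j ∈ S := fun j k hjk => by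
    induction hjk with
    | single h => exact fun hk => hS _ hk h
    | tail _ h ih => exact fun hk => ih (hS _ hk h)
  have hnew : insert i S ∈ {S : Finset V | (∀ i ∈ S, parents G i ⊆ S) ∧ p S} := by
    refine ⟨fun j hj => ?_, hs S i hi hpar (fun j hj h => hi (hclosed i j h hj)) hpS⟩
    rw [Finset.coe_insert]
    rcases Finset.mem_insert.1 hj with rfl | hj
    · exact hpar.trans (Set.subset_insert _ _)
    · exact (hS j hj).trans (Set.subset_insert _ _)
  exact hi (hmax hnew (Finset.subset_insert _ _) (Finset.mem_insert_self _ _))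

section Networks

variable {n q : ℕ}

theorem agree_univ (x : Fin n → Fin q) : agree Set.univ x = {x} := by
  ext y
  simp [agree, funext_iff]

theorem agree_anti {S T : Set (Fin n)} (h : S ⊆ T) (x : Fin n → Fin q) :
    agree T x ⊆ agree S x := fun _ hy j hj => hy j (h hj)

theorem agree_inter (S T : Set (Fin n)) (x : Fin n → Fin q) :
    agree S x ∩ agree T x = agree (S ∪ T) x := by
  ext y
  simp only [agree, Set.mem_inter_iff, Set.mem_ofPred_eq, Set.mem_union]
  grind

theorem agree_congr {S : Set (Fin n)} {x y : Fin n → Fin q} (h : ∀ j ∈ S, x j = y j) :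
    agree S x = agree S y := by
  ext z
  exact forall₂_congr fun j hj => by rw [h j hj]

theorem wt_singleton {α : Type*} [Fintype α] (p : α → ℝ) (a : α) : wt p {a} = p a := by
  classical
  simp [wt]

theorem wt_mono {α : Type*} [Fintype α] {p : α → ℝ} (hp : ∀ a, 0 ≤ p a) {E F : Set α}
    (h : E ⊆ F) : wt p E ≤ wt p F := by
  rw [← wt_add_wt_diff p h]
  linarith [wt_nonneg hp (F \ E)]

/-- Marginalization: `z` runs through the points that differ from `x` only on `B \ B'`, and each `y`
of the event on the left is matched by exactly one of them, which copies `y` on `B \ B'`. -/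
theorem wt_inter_agree (p : (Fin n → Fin q) → ℝ) (E : Set (Fin n → Fin q)) {B' B : Set (Fin n)}
    (h : B' ⊆ B) (x : Fin n → Fin q) [DecidablePred (· ∈ agree (B \ B')ᶜ x)] :
    wt p (E ∩ agree B' x) =
      ∑ z with z ∈ agree (B \ B')ᶜ x, wt p (E ∩ agree B z) := by
  classical
  simp only [wt]
  rw [Finset.sum_comm]
  refine Finset.sum_congr rfl fun y _ => ?_
  by_cases hy : y ∈ E ∩ agree B' x
  · rw [if_pos hy, Finset.sum_eq_single fun j => if j ∈ B \ B' then y j else x j]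
    · rw [if_pos]
      refine ⟨hy.1, fun j hj => ?_⟩
      by_cases hj' : j ∈ B'
      · simp [hj', hy.2 j hj']
      · simp [hj, hj']
    · intro z hz hne
      rw [if_neg]
      rintro ⟨-, hyz⟩
      refine hne (funext fun j => ?_)
      have hz := (Finset.mem_filter.1 hz).2
      split_ifs with hj
      · exact (hyz j hj.1).symm
      · exact hz j hj
    · intro hne
      refine absurd (Finset.mem_filter.2 ⟨Finset.mem_univ _, fun j hj => ?_⟩) hne
      exact if_neg hj
  · rw [if_neg hy, Finset.sum_eq_zero]
    intro z hz
    rw [if_neg]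
    rintro ⟨hyE, hyz⟩
    refine hy ⟨hyE, fun j hj => ?_⟩
    have hz := (Finset.mem_filter.1 hz).2
    rw [hyz j (h hj)]
    exact hz j fun hj' => hj'.2 hj

/-- Sum the product identity over the values on `B \ B'`. The disjointness assumptions keep the
events for `A` and `C` fixed during the summation. -/
theorem CondIndepGiven.mono {P : PMF (Fin n → Fin q)} {A B B' C : Set (Fin n)}
    (h : CondIndepGiven P A B C) (hB : B' ⊆ B) (hA : Disjoint A (B \ B'))
    (hC : Disjoint C (B \ B')) : CondIndepGiven P A B' C := by
  classical
  intro x hx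
  have key : ∀ E, pr P (E ∩ agree B' x) =
      ∑ z with z ∈ agree (B \ B')ᶜ x, pr P (E ∩ agree B z) :=
    fun E => wt_inter_agree _ E hB x
  have h1 : condPr P (agree A x ∩ agree B' x) (agree C x) =
      ∑ z with z ∈ agree (B \ B')ᶜ x, condPr P (agree A x ∩ agree B z) (agree C x) := by
    simp only [condPr]
    rw [Set.inter_right_comm, key, Finset.sum_div]
    exact Finset.sum_congr rfl fun z _ => by rw [Set.inter_right_comm]
  have h2 : condPr P (agree B' x) (agree C x) =
      ∑ z with z ∈ agree (B \ B')ᶜ x, condPr P (agree B z) (agree C x) := by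
    simp only [condPr]
    rw [Set.inter_comm, key, Finset.sum_div]
    exact Finset.sum_congr rfl fun z _ => by rw [Set.inter_comm]
  rw [h1, h2, Finset.mul_sum]
  refine Finset.sum_congr rfl fun z hz => ?_
  have hz := (Finset.mem_filter.1 hz).2
  have hAz : agree A x = agree A z :=
    agree_congr fun j hj => (hz j (Set.disjoint_left.1 hA hj)).symm
  have hCz : agree C x = agree C z :=
    agree_congr fun j hj => (hz j (Set.disjoint_left.1 hC hj)).symm
  rw [hAz, hCz]
  exact h z (hCz ▸ hx)

/-- The conditional probability of `x i` given the values of `x` at the parents of `i`. -/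
noncomputable def localFactor (P : PMF (Fin n → Fin q)) (G : Digraph (Fin n)) (i : Fin n)
    (x : Fin n → Fin q) : ℝ :=
  pr P (agree (insert i (parents G i)) x) / pr P (agree (parents G i) x)

theorem pr_mono (P : PMF (Fin n → Fin q)) {E F : Set (Fin n → Fin q)} (h : E ⊆ F) :
    pr P E ≤ pr P F := wt_mono (fun _ => ENNReal.toReal_nonneg) h

theorem pr_nonneg (P : PMF (Fin n → Fin q)) (E : Set (Fin n → Fin q)) : 0 ≤ pr P E :=
  wt_nonneg (fun _ => ENNReal.toReal_nonneg) E

theorem PMF.sum_toReal {α : Type*} [Fintype α] (P : PMF α) : ∑ a, (P a).toReal = 1 := by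
  rw [← ENNReal.toReal_sum fun a _ => P.apply_ne_top a, ← tsum_fintype (L := .unconditional _),
    P.tsum_coe, ENNReal.toReal_one]

/-- The joint distribution of a Bayesian network is the product of its local factors. -/
theorem bayesNets_factor {G : Digraph (Fin n)} (hG : IsDAG G) {P : PMF (Fin n → Fin q)}
    (hP : P ∈ bayesNets q G) (x : Fin n → Fin q) : (P x).toReal = ∏ i, localFactor P G i x := by
  have h : pr P (agree (Finset.univ : Finset (Fin n)) x) = ∏ i, localFactor P G i x := by
    refine hG.induction (p := fun S => pr P (agree S x) = ∏ i ∈ S, localFactor P G i x) ?_ ?_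
    · simp [agree, pr, PMF.sum_toReal]
    intro S i hi hpar hdesc ih
    rw [Finset.prod_insert hi, ← ih, Finset.coe_insert, localFactor]
    have hS := pr_mono P (agree_anti hpar x)
    have hiS := pr_mono P (agree_anti (Set.subset_insert i (S : Set (Fin n))) x)
    -- If the parent values have probability zero, the local factor is 0 by division by zero, and
    -- the left side vanishes by monotonicity.
    by_cases h0 : pr P (agree (parents G i) x) = 0
    · have := pr_nonneg P (agree (insert i (S : Set (Fin n))) x)
      rw [h0, div_zero, zero_mul]
      linarith
    have hSN : (S : Set (Fin n)) ⊆ nonDescendants G i := fun j hj =>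
      ⟨fun h => hi (h ▸ hj), hdesc j hj⟩
    -- Since `S` contains the parents of `i` and no descendant of `i`, the Markov property
    -- restricted to `S` says that conditioning `i` on `S` is the same as conditioning it on its
    -- parents.
    have hind := (hP i).mono hSN
      (Set.disjoint_left.2 fun j hj hj' => hj'.1.1 hj)
      (Set.disjoint_left.2 fun j hj hj' => hj'.2 (hpar hj)) x h0
    simp only [condPr, agree_inter] at hind
    rw [Set.union_eq_left.2 hpar, Set.union_assoc, Set.union_eq_left.2 hpar, Set.singleton_union,
      Set.singleton_union] at hind
    field_simp at hind ⊢
    linarith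
  rw [← h, Finset.coe_univ, agree_univ]
  exact (wt_singleton (fun y => (P y).toReal) x).symm

/-! ### Normalization of products of kernels and of the smoothed estimate. -/

/-- Exchanging `a` with the coordinate `x i` is an involution on pairs. It allows one coordinate to
be summed out without splitting the function space. -/
theorem sum_sum_update (i : Fin n) (F : (Fin n → Fin q) → ℝ) :
    ∑ x, ∑ a, F (Function.update x i a) = q * ∑ x, F x := by
  have hinv : Function.Involutive fun z : (Fin n → Fin q) × Fin q =>
      (Function.update z.1 i z.2, z.1 i) := fun z => by simp
  rw [← Fintype.sum_prod_type' (f := fun x a => F (Function.update x i a)),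
    ← Equiv.sum_comp hinv.toPerm, Fintype.sum_prod_type]
  simp [Finset.mul_sum]

/-- A product of conditional distributions along a graph without cycles is a distribution. -/
theorem sum_prod_kernel_eq_one {G : Digraph (Fin n)} (hG : IsDAG G)
    {K : Fin n → (Fin n → Fin q) → ℝ} (hq : 1 ≤ q)
    (hdep : ∀ i x y, (∀ j ∈ insert i (parents G i), x j = y j) → K i x = K i y)
    (hsum : ∀ i x, ∑ a, K i (Function.update x i a) = 1) : ∑ x, ∏ i, K i x = 1 := by
  have hq0 : (q : ℝ) ≠ 0 := by positivity
  -- The sum always runs over all coordinates, so those outside `S` contribute a factor q^(n - |S|);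
  -- multiplying by q^|S| avoids the subtraction.
  have h : (q : ℝ) ^ (Finset.univ : Finset (Fin n)).card * ∑ x, ∏ i, K i x = (q : ℝ) ^ n := by
    refine hG.induction
      (p := fun S => (q : ℝ) ^ S.card * ∑ x, ∏ i ∈ S, K i x = (q : ℝ) ^ n) (by simp) ?_
    intro S i hi hpar hdesc ih
    rw [Finset.card_insert_of_notMem hi, pow_succ, mul_assoc, ← sum_sum_update i, ← ih]
    congr 1
    refine Finset.sum_congr rfl fun x _ => ?_
    have : ∀ a, ∏ j ∈ insert i S, K j (Function.update x i a) =
        K i (Function.update x i a) * ∏ j ∈ S, K j x := fun a => by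
      rw [Finset.prod_insert hi]
      congr 1
      refine Finset.prod_congr rfl fun j hj => hdep j _ _ fun k hk => ?_
      refine Function.update_of_ne ?_ _ _
      rintro rfl
      rcases hk with rfl | hk
      · exact hi hj
      · exact hdesc j hj (.single hk)
    simp only [this]
    rw [← Finset.sum_mul, hsum, one_mul]
  rw [Finset.card_univ, Fintype.card_fin] at h
  exact mul_left_cancel₀ (pow_ne_zero n hq0) (h.trans (mul_one _).symm)

/-- The Laplace estimator of a local factor from the samples `T`. -/
noncomputable def laplace (G : Digraph (Fin n)) {m : ℕ} (T : Fin m → Fin n → Fin q) (i : Fin n)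
    (x : Fin n → Fin q) : ℝ :=
  (hits (agree (insert i (parents G i)) x) T + 1) / (hits (agree (parents G i) x) T + q)

/-- The estimated network. -/
noncomputable def netEstimate (G : Digraph (Fin n)) {m : ℕ} (T : Fin m → Fin n → Fin q)
    (x : Fin n → Fin q) : ℝ := ∏ i, laplace G T i x

theorem laplace_pos (G : Digraph (Fin n)) {m : ℕ} (T : Fin m → Fin n → Fin q) (i : Fin n)
    (x : Fin n → Fin q) : 0 < laplace G T i x := by
  have h1 := hits_nonneg (agree (insert i (parents G i)) x) T
  have h2 := hits_nonneg (agree (parents G i) x) T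
  have : 0 < q := (x i).pos
  unfold laplace
  positivity

theorem netEstimate_pos (G : Digraph (Fin n)) {m : ℕ} (T : Fin m → Fin n → Fin q)
    (x : Fin n → Fin q) : 0 < netEstimate G T x :=
  Finset.prod_pos fun i _ => laplace_pos G T i x

/-- Over the q values of a node the family counts add up to the parent count and the pseudo-counts 1
add up to q, so each smoothed factor is an exact conditional distribution. -/
theorem sum_netEstimate {G : Digraph (Fin n)} (hG : IsDAG G) (hq : 1 ≤ q) {m : ℕ}
    (T : Fin m → Fin n → Fin q) : ∑ x, netEstimate G T x = 1 := by
  classical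
  refine sum_prod_kernel_eq_one hG hq (fun i x y h => ?_) fun i x => ?_
  · rw [laplace, agree_congr h, agree_congr fun j hj => h j (Set.mem_insert_of_mem i hj), laplace]
  have hi : i ∉ parents G i := fun h => hG i (.single h)
  have hpar : ∀ a, agree (parents G i) (Function.update x i a) = agree (parents G i) x :=
    fun a => agree_congr fun j hj => Function.update_of_ne (by rintro rfl; exact hi hj) _ _
  have hsum : ∑ a, hits (agree (insert i (parents G i)) (Function.update x i a)) T =
      hits (agree (parents G i) x) T := by
    simp only [hits]
    rw [Finset.sum_comm]
    refine Finset.sum_congr rfl fun t _ => ?_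
    have : ∀ a, T t ∈ agree (insert i (parents G i)) (Function.update x i a) ↔
        a = T t i ∧ T t ∈ agree (parents G i) x := fun a => by
      rw [← hpar a, Set.insert_eq, ← agree_inter]
      simp [agree, eq_comm]
    simp only [this]
    by_cases h : T t ∈ agree (parents G i) x <;> simp [h]
  have h2 := hits_nonneg (agree (parents G i) x) T
  have hq' : (0 : ℝ) < q := by positivity
  simp only [laplace, hpar]
  rw [← Finset.sum_div, Finset.sum_add_distrib, hsum]
  simp only [Finset.sum_const, Finset.card_univ, Fintype.card_fin, nsmul_eq_mul, mul_one]
  exact div_self (by positivity)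

end Networks

/-! ### Error analysis -/

/-- The total variation distance is at most the square root of the relative entropy; stated for an
upper bound `D` of the log-likelihood ratio. -/
theorem sq_half_sum_abs_sub_le {α : Type*} [Fintype α] {p r D : α → ℝ} (hp : ∀ a, 0 ≤ p a)
    (hr : ∀ a, 0 < r a) (hp1 : ∑ a, p a = 1) (hr1 : ∑ a, r a = 1)
    (hD : ∀ a, 0 < p a → Real.log (p a / r a) ≤ D a) :
    ((1 / 2) * ∑ a, |p a - r a|) ^ 2 ≤ ∑ a, p a * D a := by
  -- Comparison of the squared Hellinger distance with relative entropy, from log √(r/p) ≤ √(r/p) -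
  -- 1. The correction r - p sums to zero.
  have h1 : ∀ a, p a + r a - 2 * (√(p a) * √(r a)) - (r a - p a) ≤ p a * D a := fun a => by
    rcases (hp a).eq_or_lt with h0 | h0
    · simp [← h0]
    have hs : √(p a) * √(r a) = p a * √(r a / p a) := by
      rw [Real.sqrt_div (hr a).le]
      nth_rw 2 [← Real.mul_self_sqrt h0.le]
      field_simp
    have hl : Real.log (p a / r a) = -(2 * Real.log √(r a / p a)) := by
      rw [Real.log_sqrt (div_pos (hr a) h0).le, ← inv_div, Real.log_inv]
      ring
    have := Real.log_le_sub_one_of_pos (Real.sqrt_pos.2 (div_pos (hr a) h0))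
    have h2 := hD a h0
    rw [hs]
    nlinarith
  have h2 : ∑ a, (√(p a) - √(r a)) ^ 2 ≤ ∑ a, p a * D a := by
    calc ∑ a, (√(p a) - √(r a)) ^ 2
        = ∑ a, (p a + r a - 2 * (√(p a) * √(r a)) - (r a - p a)) + (∑ a, r a - ∑ a, p a) := by
          rw [← Finset.sum_sub_distrib, ← Finset.sum_add_distrib]
          refine Finset.sum_congr rfl fun a _ => ?_
          rw [sub_sq, Real.sq_sqrt (hp a), Real.sq_sqrt (hr a).le]
          ring
      _ ≤ _ := by
          rw [hp1, hr1, sub_self, add_zero]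
          exact Finset.sum_le_sum fun a _ => h1 a
  have h3 : ∑ a, (√(p a) + √(r a)) ^ 2 ≤ 4 := by
    calc ∑ a, (√(p a) + √(r a)) ^ 2 ≤ ∑ a, (2 * p a + 2 * r a) :=
          Finset.sum_le_sum fun a _ => by
            have := Real.sq_sqrt (hp a)
            have := Real.sq_sqrt (hr a).le
            nlinarith [sq_nonneg (√(p a) - √(r a))]
      _ = 4 := by
          rw [Finset.sum_add_distrib, ← Finset.mul_sum, ← Finset.mul_sum, hp1, hr1]
          norm_num
  -- Factor the difference of squares and apply Cauchy–Schwarz: the second factor is at most 4,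
  -- which cancels against the square of 1/2.
  have h4 : ∑ a, |p a - r a| = ∑ a, |√(p a) - √(r a)| * (√(p a) + √(r a)) :=
    Finset.sum_congr rfl fun a _ => by
      rw [← abs_of_nonneg (add_nonneg (Real.sqrt_nonneg (p a)) (Real.sqrt_nonneg (r a))), ← abs_mul]
      congr 1
      linear_combination -Real.sq_sqrt (hp a) + Real.sq_sqrt (hr a).le
  have h5 := Finset.sum_mul_sq_le_sq_mul_sq Finset.univ (fun a => |√(p a) - √(r a)|)
    fun a => √(p a) + √(r a)
  rw [← h4] at h5
  simp only [sq_abs] at h5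
  have h6 : 0 ≤ ∑ a, (√(p a) - √(r a)) ^ 2 := Finset.sum_nonneg fun a _ => sq_nonneg _
  nlinarith

/-! ### Mean square error of the distance estimate. -/

section

variable {n q : ℕ}

/-- A linearized log-likelihood ratio of a network and its estimate. -/
noncomputable def excess (P : PMF (Fin n → Fin q)) (G : Digraph (Fin n)) {m : ℕ}
    (T : Fin m → Fin n → Fin q) : ℝ :=
  ∑ x, (P x).toReal * ∑ i, (localFactor P G i x / laplace G T i x - 1)

/-- The log-likelihood ratio is a sum over nodes, and log t ≤ t - 1 linearizes each term, so that
expectations over the training samples become computable. Only points of positive probability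
matter; all local factors are positive there. -/
theorem sq_tv_netEstimate_le {P : PMF (Fin n → Fin q)} {G : Digraph (Fin n)} (hG : IsDAG G)
    (hP : P ∈ bayesNets q G) (hq : 1 ≤ q) {m : ℕ} (T : Fin m → Fin n → Fin q) :
    ((1 / 2) * ∑ x, |(P x).toReal - netEstimate G T x|) ^ 2 ≤ excess P G T := by
  refine sq_half_sum_abs_sub_le (fun _ => ENNReal.toReal_nonneg) (netEstimate_pos G T)
    P.sum_toReal (sum_netEstimate hG hq T) fun x hx => ?_
  have hf := bayesNets_factor hG hP x
  have hpos : ∀ i, 0 < localFactor P G i x := fun i => by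
    refine lt_of_le_of_ne (div_nonneg (pr_nonneg _ _) (pr_nonneg _ _)) fun h => ?_
    rw [hf, Finset.prod_eq_zero (Finset.mem_univ i) h.symm] at hx
    exact lt_irrefl _ hx
  rw [hf, netEstimate, ← Finset.prod_div_distrib, Real.log_prod fun i _ =>
    (div_pos (hpos i) (laplace_pos G T i x)).ne']
  exact Finset.sum_le_sum fun i _ =>
    Real.log_le_sub_one_of_pos (div_pos (hpos i) (laplace_pos G T i x))

/-- The restrictions to `S` take at most q^d values, and each contributes at most 1. -/
theorem sum_div_pr_agree_le (P : PMF (Fin n → Fin q)) {S : Set (Fin n)} {d : ℕ}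
    (hS : S.encard ≤ d) (hq : 1 ≤ q) :
    ∑ x, (P x).toReal / pr P (agree S x) ≤ (q : ℝ) ^ d := by
  classical
  have h := sum_div_wt_fiber_le (fun x => (P x).toReal)
    (fun (x : Fin n → Fin q) (j : S) => x j)
  have h2 : ∀ x : Fin n → Fin q,
      {y : Fin n → Fin q | (fun j : S => y j) = fun j : S => x j} = agree S x := fun x => by
    ext y
    simp [agree, funext_iff]
  simp only [h2] at h
  refine h.trans ?_
  have hc : Fintype.card S ≤ d := by
    rw [← Set.toFinset_card]
    rw [Set.encard_eq_coe_toFinset_card] at hS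
    exact_mod_cast hS
  rw [Fintype.card_fun, Fintype.card_fin]
  exact_mod_cast Nat.pow_le_pow_right hq hc

/-- At node `i` and point `x` the inverse Laplace factor has relative bias at most (q - 1) / ((m +
1) P(parents)). Averaged over `x`, the inverse probability becomes at most q^d, for each of the n
nodes. -/
theorem iidE_excess_le (P : PMF (Fin n → Fin q)) {G : Digraph (Fin n)} {d : ℕ}
    (hd : InDegreeLE G d) (hq : 1 ≤ q) (m : ℕ) :
    iidE (fun x => (P x).toReal) m (excess P G) ≤ q ^ (d + 1) * n / (m + 1) := by
  have hp : ∀ x, 0 ≤ (P x).toReal := fun _ => ENNReal.toReal_nonneg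
  have hq' : (1 : ℝ) ≤ q := by exact_mod_cast hq
  have key : ∀ x i, (P x).toReal * iidE (fun x => (P x).toReal) m (fun T =>
      localFactor P G i x / laplace G T i x - 1) ≤
      (P x).toReal * ((q - 1) / (m + 1) / pr P (agree (parents G i) x)) := fun x i => by
    rcases (hp x).eq_or_lt with h0 | h0
    · simp [← h0]
    refine mul_le_mul_of_nonneg_left ?_ (hp x)
    have hx : {x} ⊆ agree (parents G i) x := by simp [agree]
    have hpr : 0 < pr P (agree (parents G i) x) :=
      h0.trans_le ((wt_singleton (fun y => (P y).toReal) x).symm.trans_le (pr_mono P hx))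
    have h := iidE_inv_laplace_le hp P.sum_toReal
      (agree_anti (Set.subset_insert i (parents G i)) x) hq' m
    have h2 : (iidE (fun x => (P x).toReal) m fun T =>
        localFactor P G i x / laplace G T i x - 1) =
        (pr P (agree (parents G i) x))⁻¹ * (pr P (agree (insert i (parents G i)) x) *
          iidE (fun x => (P x).toReal) m fun T => (hits (agree (parents G i) x) T + q) /
            (hits (agree (insert i (parents G i)) x) T + 1)) + -1 := by
      rw [← iidE_const P.sum_toReal m (-1), ← iidE_const_mul, ← iidE_const_mul, ← iidE_add]
      congr 1
      funext T
      rw [laplace, localFactor, div_div_eq_mul_div, ← sub_eq_add_neg]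
      ring
    rw [h2]
    change pr P _ * _ ≤ pr P _ + _ at h
    have h3 := mul_le_mul_of_nonneg_left h (inv_nonneg.2 hpr.le)
    rw [mul_add, inv_mul_cancel₀ hpr.ne'] at h3
    rw [div_eq_inv_mul _ (pr P _)]
    linarith
  have h1 : iidE (fun x => (P x).toReal) m (excess P G) =
      ∑ x, ∑ i, (P x).toReal * iidE (fun x => (P x).toReal) m (fun T =>
        localFactor P G i x / laplace G T i x - 1) := by
    simp only [← Finset.mul_sum, ← iidE_sum, ← iidE_const_mul]
    rfl
  rw [h1]
  calc _ ≤ ∑ x, ∑ i, (P x).toReal * (((q : ℝ) - 1) / (m + 1) / pr P (agree (parents G i) x)) :=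
        Finset.sum_le_sum fun x _ => Finset.sum_le_sum fun i _ => key x i
    _ = ((q : ℝ) - 1) / (m + 1) * ∑ i, ∑ x, (P x).toReal / pr P (agree (parents G i) x) := by
        rw [Finset.sum_comm]
        simp only [Finset.mul_sum]
        exact Finset.sum_congr rfl fun i _ => Finset.sum_congr rfl fun x _ => by ring
    _ ≤ ((q : ℝ) - 1) / (m + 1) * ∑ i : Fin n, (q : ℝ) ^ d :=
        mul_le_mul_of_nonneg_left
          (Finset.sum_le_sum fun i _ => sum_div_pr_agree_le P (hd i) hq)
          (div_nonneg (by linarith) (by positivity))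
    _ ≤ q / (m + 1) * ∑ i : Fin n, (q : ℝ) ^ d := by
        gcongr
        linarith
    _ = _ := by
        simp
        ring

/-- The estimate of the distance of two networks from training samples `T` and `U` and test samples
`Z` from the first distribution. -/
noncomputable def tvEstimate (G₁ G₂ : Digraph (Fin n)) {m : ℕ}
    (T U Z : Fin m → Fin n → Fin q) : ℝ :=
  (∑ t, max 0 (1 - netEstimate G₂ U (Z t) / netEstimate G₁ T (Z t))) / m

/-- The summand is the positive part of p - r, which is half of (p - r) + |p - r|, and the signed
part sums to zero. This turns the distance of the two estimates into the expectation of a bounded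
function. -/
theorem sum_mul_max_eq {α : Type*} [Fintype α] {p r : α → ℝ} (hp : ∀ a, 0 < p a)
    (hp1 : ∑ a, p a = 1) (hr1 : ∑ a, r a = 1) :
    ∑ a, p a * max 0 (1 - r a / p a) = (1 / 2) * ∑ a, |p a - r a| := by
  have h : ∀ a, p a * max 0 (1 - r a / p a) = (1 / 2) * ((p a - r a) + |p a - r a|) := fun a => by
    have hpa := hp a
    rw [mul_max_of_nonneg _ _ hpa.le, mul_zero, mul_sub, mul_one, mul_div_cancel₀ _ hpa.ne']
    rcases le_total 0 (p a - r a) with h | h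
    · rw [max_eq_right h, abs_of_nonneg h]
      ring
    · rw [max_eq_left h, abs_of_nonpos h]
      ring
  simp only [h]
  rw [← Finset.mul_sum, Finset.sum_add_distrib, Finset.sum_sub_distrib, hp1, hr1, sub_self,
    zero_add]

/-- Let a and b be the distances of P and Q to their estimates. The error has three sources: the
fluctuation w/m of the average, the use of P in place of its estimate (at most 2a), and the distance
of the estimates in place of the true one (at most a + b). Squaring |w/m| + 3a + b costs a factor 3,
whence 27 a² + 3 b² + 3 (w/m)². -/
theorem sq_tvEstimate_sub_le {P Q : PMF (Fin n → Fin q)} {G₁ G₂ : Digraph (Fin n)}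
    (h₁ : IsDAG G₁) (h₂ : IsDAG G₂) (hP : P ∈ bayesNets q G₁) (hQ : Q ∈ bayesNets q G₂)
    (hq : 1 ≤ q) {m : ℕ} (hm : 0 < m) (T U Z : Fin m → Fin n → Fin q) :
    (tvEstimate G₁ G₂ T U Z - tvDist P Q) ^ 2 ≤
      27 * excess P G₁ T + 3 * excess Q G₂ U + 3 / m ^ 2 *
        (∑ t, (max 0 (1 - netEstimate G₂ U (Z t) / netEstimate G₁ T (Z t)) -
          ∑ x, (P x).toReal * max 0 (1 - netEstimate G₂ U x / netEstimate G₁ T x))) ^ 2 := by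
  have hp1 := sum_netEstimate h₁ hq T
  have hr1 := sum_netEstimate h₂ hq U
  have hp0 := netEstimate_pos G₁ T
  have hr0 := netEstimate_pos G₂ U
  have hJ1 := sq_tv_netEstimate_le h₁ hP hq T
  have hJ2 := sq_tv_netEstimate_le h₂ hQ hq U
  unfold tvEstimate tvDist
  set p := netEstimate G₁ T
  set r := netEstimate G₂ U
  set f : (Fin n → Fin q) → ℝ := fun x => max 0 (1 - r x / p x) with hf
  have hf0 : ∀ x, 0 ≤ f x := fun x => le_max_left _ _
  have hf1 : ∀ x, f x ≤ 1 := fun x => max_le zero_le_one (by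
    have := div_nonneg (hr0 x).le (hp0 x).le
    linarith)
  set a := (1 / 2) * ∑ x, |(P x).toReal - p x| with ha
  set b := (1 / 2) * ∑ x, |(Q x).toReal - r x| with hb
  set μ := ∑ x, (P x).toReal * f x
  set w := ∑ t, (f (Z t) - μ) with hw
  have hm' : (0 : ℝ) < m := by exact_mod_cast hm
  have e1 : (∑ t, f (Z t)) / m = w / m + μ := by
    rw [hw, Finset.sum_sub_distrib]
    simp
    field_simp
    ring
  have e2 : |μ - (1 / 2) * (∑ x, |p x - r x|)| ≤ 2 * a := by
    rw [← sum_mul_max_eq hp0 hp1 hr1, ← Finset.sum_sub_distrib, ha]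
    refine (Finset.abs_sum_le_sum_abs _ _).trans ?_
    rw [← mul_assoc]
    norm_num
    refine Finset.sum_le_sum fun x _ => ?_
    change |(P x).toReal * f x - p x * f x| ≤ _
    rw [← sub_mul, abs_mul, abs_of_nonneg (hf0 x)]
    exact mul_le_of_le_one_right (abs_nonneg _) (hf1 x)
  have e3 : |(1 / 2) * (∑ x, |p x - r x|) - (1 / 2) * (∑ x, |(P x).toReal - (Q x).toReal|)| ≤
      a + b := by
    rw [← mul_sub, ← Finset.sum_sub_distrib, abs_mul, ha, hb, ← mul_add, ← Finset.sum_add_distrib]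
    rw [abs_of_pos (by norm_num : (0 : ℝ) < 1 / 2)]
    refine mul_le_mul_of_nonneg_left ?_ (by norm_num)
    refine (Finset.abs_sum_le_sum_abs _ _).trans (Finset.sum_le_sum fun x _ => ?_)
    refine (abs_abs_sub_abs_le_abs_sub _ _).trans ?_
    rw [abs_sub_comm (P x).toReal]
    refine le_trans (le_of_eq ?_) (abs_add_le (p x - (P x).toReal) ((Q x).toReal - r x))
    congr 1
    ring
  have e4 : |(∑ t, f (Z t)) / m - (1 / 2) * (∑ x, |(P x).toReal - (Q x).toReal|)| ≤
      |w / m| + 3 * a + b := by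
    rw [e1]
    rw [abs_le] at e2 e3 ⊢
    have := neg_abs_le (w / m)
    have := le_abs_self (w / m)
    constructor <;> linarith
  have e5 : (3 : ℝ) / m ^ 2 * w ^ 2 = 3 * |w / m| ^ 2 := by
    rw [sq_abs]
    field_simp
  rw [e5, ← sq_abs]
  refine (pow_le_pow_left₀ (abs_nonneg _) e4 2).trans ?_
  nlinarith [sq_nonneg (|w / m| - 3 * a), sq_nonneg (|w / m| - b), sq_nonneg (3 * a - b)]

/-- The mean square error of the estimate. -/
theorem iidE_sq_tvEstimate_sub_le {P Q : PMF (Fin n → Fin q)} {G₁ G₂ : Digraph (Fin n)}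
    (h₁ : IsDAG G₁) (h₂ : IsDAG G₂) (hP : P ∈ bayesNets q G₁) (hQ : Q ∈ bayesNets q G₂)
    (hn : 1 ≤ n) (hq : 1 ≤ q) {d : ℕ} (hd₁ : InDegreeLE G₁ d) (hd₂ : InDegreeLE G₂ d)
    {m : ℕ} (hm : 0 < m) :
    (iidE (fun x => (P x).toReal) m fun T => iidE (fun x => (Q x).toReal) m fun U =>
      iidE (fun x => (P x).toReal) m fun Z => (tvEstimate G₁ G₂ T U Z - tvDist P Q) ^ 2) ≤
      33 * (q ^ (d + 1) * n) / m := by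
  have hp : ∀ x, 0 ≤ (P x).toReal := fun _ => ENNReal.toReal_nonneg
  have hr : ∀ x, 0 ≤ (Q x).toReal := fun _ => ENNReal.toReal_nonneg
  have hm' : (0 : ℝ) < m := by exact_mod_cast hm
  have hqn : (1 : ℝ) ≤ q ^ (d + 1) * n := by
    exact_mod_cast Nat.mul_pos (Nat.pow_pos hq) hn
  have h5 := iidE_excess_le P hd₁ hq m
  have h5' := iidE_excess_le Q hd₂ hq m
  generalize (q ^ (d + 1) * n : ℝ) = N at *
  have hNm : N / (m + 1) ≤ N / m := by gcongr; linarith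
  have s1 : ∀ T U, (iidE (fun x => (P x).toReal) m fun Z =>
      (tvEstimate G₁ G₂ T U Z - tvDist P Q) ^ 2) ≤
      27 * excess P G₁ T + (3 * excess Q G₂ U + 3 / m) := fun T U => by
    refine (iidE_mono hp fun Z => sq_tvEstimate_sub_le h₁ h₂ hP hQ hq hm T U Z).trans ?_
    rw [iidE_add, iidE_const P.sum_toReal, iidE_const_mul, add_assoc]
    set f : (Fin n → Fin q) → ℝ :=
      fun x => max 0 (1 - netEstimate G₂ U x / netEstimate G₁ T x) with hf
    have hf0 : ∀ x, 0 ≤ f x := fun x => le_max_left _ _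
    have hf1 : ∀ x, f x ≤ 1 := fun x => max_le zero_le_one (by
      have := div_nonneg (netEstimate_pos G₂ U x).le (netEstimate_pos G₁ T x).le
      linarith)
    set μ := ∑ x, (P x).toReal * f x with hμ
    have hμ0 : 0 ≤ μ := Finset.sum_nonneg fun x _ => mul_nonneg (hp x) (hf0 x)
    have hμ1 : μ ≤ 1 := by
      rw [← P.sum_toReal]
      exact Finset.sum_le_sum fun x _ => mul_le_of_le_one_right (hp x) (hf1 x)
    -- With `T` and `U` fixed, the loss is a fixed function into [0, 1], so the sum over the
    -- independent test samples has variance at most m.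
    have hv := iidE_sq_sum_le hp P.sum_toReal (g := fun x => f x - μ)
      (by simp [mul_sub, Finset.sum_sub_distrib, ← Finset.sum_mul, P.sum_toReal, hμ])
      (fun x => abs_le.2 ⟨by linarith [hf0 x], by linarith [hf1 x]⟩) m
    have := mul_le_mul_of_nonneg_left hv (by positivity : (0 : ℝ) ≤ 3 / m ^ 2)
    have e : (3 : ℝ) / m ^ 2 * m = 3 / m := by field_simp
    rw [e] at this
    linarith
  have s2 : ∀ T, (iidE (fun x => (Q x).toReal) m fun U => iidE (fun x => (P x).toReal) m fun Z =>
      (tvEstimate G₁ G₂ T U Z - tvDist P Q) ^ 2) ≤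
      27 * excess P G₁ T + (3 * (N / m) + 3 / m) := fun T => by
    refine (iidE_mono hr fun U => s1 T U).trans ?_
    rw [iidE_add, iidE_const Q.sum_toReal, iidE_add, iidE_const Q.sum_toReal, iidE_const_mul]
    linarith
  refine (iidE_mono hp s2).trans ?_
  rw [iidE_add, iidE_const P.sum_toReal, iidE_const_mul]
  -- The variance term is absorbed using 1 ≤ N; the total is 27 + 3 + 3 = 33.
  have h6 : 3 / (m : ℝ) ≤ 3 * (N / m) := by
    rw [← mul_div_assoc]
    gcongr
    linarith
  rw [mul_div_assoc]
  linarith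

end

/-! ### From expectations over samples to the law of the tapes -/

theorem infinitePi_prefix {α : Type*} [MeasurableSpace α] [MeasurableSingletonClass α] (P : PMF α)
    {N : ℕ} (X : Fin N → α) :
    (Measure.infinitePi fun _ : ℕ => P.toMeasure) {ω | ∀ k : Fin N, ω k = X k} =
      ∏ k, P (X k) := by
  have h : {ω : ℕ → α | ∀ k : Fin N, ω k = X k} =
      Set.pi (Finset.range N) fun k => if h : k < N then {X ⟨k, h⟩} else Set.univ := by
    ext ω
    simp only [Set.mem_ofPred_eq, Set.mem_pi, Finset.coe_range, Set.mem_Iio]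
    constructor
    · intro h k hk
      simp [hk, h ⟨k, hk⟩]
    · intro h k
      simpa using h k k.2
  rw [h, Measure.infinitePi_pi, Finset.prod_range]
  · refine Finset.prod_congr rfl fun k _ => ?_
    simp [PMF.toMeasure_apply_singleton]
  · intro k hk
    split_ifs
    · exact measurableSet_singleton _
    · exact MeasurableSet.univ

namespace RealRAM

variable {n q : ℕ}

/-- The tapes with a given beginning. -/
def cylinder {m : ℕ} (T U Z : Fin m → Fin n → Fin q) : Set (Tape n q) :=
  {ω | ∀ k : Fin (m + m), ω k = Fin.append T Z k} ×ˢ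
    ({ω | ∀ k : Fin m, ω k = U k} ×ˢ Set.univ)

theorem measurableSet_cylinder {m : ℕ} (T U Z : Fin m → Fin n → Fin q) :
    MeasurableSet (cylinder T U Z) := by
  have h : ∀ {N : ℕ} (X : Fin N → Fin n → Fin q),
      MeasurableSet {ω : ℕ → Fin n → Fin q | ∀ k : Fin N, ω k = X k} := fun X => by
    rw [Set.ofPred_forall]
    exact MeasurableSet.iInter fun k => measurable_pi_apply (k : ℕ) (measurableSet_singleton _)
  exact (h _).prod ((h _).prod MeasurableSet.univ)

/-- Training and test samples from P come from the same tape, one batch after the other; hence the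
prefix of length m + m and the shift by m for `Z`. -/
theorem mem_cylinder {m : ℕ} {T U Z : Fin m → Fin n → Fin q} {ω : Tape n q} :
    ω ∈ cylinder T U Z ↔ T = (fun t : Fin m => ω.1 t) ∧ U = (fun t : Fin m => ω.2.1 t) ∧
      Z = fun t : Fin m => ω.1 (m + t) := by
  simp only [cylinder, Set.mem_prod, Set.mem_ofPred_eq, Set.mem_univ, and_true]
  constructor
  · rintro ⟨h1, h2⟩
    refine ⟨funext fun t => ?_, funext fun t => (h2 t).symm, funext fun t => ?_⟩
    · have := h1 (Fin.castAdd m t)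
      rw [Fin.append_left] at this
      exact this.symm
    · have := h1 (Fin.natAdd m t)
      rw [Fin.append_right] at this
      exact this.symm
  · rintro ⟨rfl, rfl, rfl⟩
    refine ⟨fun k => ?_, fun t => rfl⟩
    induction k using Fin.addCases with
    | left t => rw [Fin.append_left]; rfl
    | right t => rw [Fin.append_right]; rfl

theorem tapeLaw_cylinder (P Q : PMF (Fin n → Fin q)) {m : ℕ} (T U Z : Fin m → Fin n → Fin q) :
    tapeLaw P Q (cylinder T U Z) = ENNReal.ofReal ((∏ t, (P (T t)).toReal) *
      ((∏ t, (Q (U t)).toReal) * ((∏ t, (P (Z t)).toReal) * 1))) := by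
  rw [tapeLaw, cylinder, Measure.prod_prod, Measure.prod_prod, infinitePi_prefix,
    infinitePi_prefix, measure_univ, mul_one, Fin.prod_univ_add]
  simp only [Fin.append_left, Fin.append_right, mul_one, ← ENNReal.toReal_prod,
    ← ENNReal.toReal_mul]
  rw [ENNReal.ofReal_toReal]
  · ring
  · exact ENNReal.mul_ne_top (ENNReal.prod_ne_top fun _ _ => P.apply_ne_top _)
      (ENNReal.mul_ne_top (ENNReal.prod_ne_top fun _ _ => Q.apply_ne_top _)
        (ENNReal.prod_ne_top fun _ _ => P.apply_ne_top _))

/-- Markov's inequality for an error that depends on the beginnings of the tapes. -/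
theorem two_thirds_le_tapeLaw (P Q : PMF (Fin n → Fin q)) {m : ℕ}
    (err : (Fin m → Fin n → Fin q) → (Fin m → Fin n → Fin q) → (Fin m → Fin n → Fin q) → ℝ)
    (h0 : ∀ T U Z, 0 ≤ err T U Z) {δ : ℝ} (hδ : 0 < δ)
    (h : (iidE (fun x => (P x).toReal) m fun T => iidE (fun x => (Q x).toReal) m fun U =>
      iidE (fun x => (P x).toReal) m fun Z => err T U Z) ≤ δ / 3) :
    2 / 3 ≤ tapeLaw P Q {ω | err (fun t => ω.1 t) (fun t => ω.2.1 t) (fun t => ω.1 (m + t)) ≤ δ} := by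
  classical
  have hp : ∀ x, 0 ≤ (P x).toReal := fun _ => ENNReal.toReal_nonneg
  have hr : ∀ x, 0 ≤ (Q x).toReal := fun _ => ENNReal.toReal_nonneg
  -- Markov's inequality in the pointwise form 1 - err / δ ≤ 1_{err ≤ δ}.
  have h1 : 2 / 3 ≤ (iidE (fun x => (P x).toReal) m fun T => iidE (fun x => (Q x).toReal) m fun U =>
      iidE (fun x => (P x).toReal) m fun Z => if err T U Z ≤ δ then 1 else 0) := by
    have e : 1 + (-δ⁻¹) * (iidE (fun x => (P x).toReal) m fun T =>
        iidE (fun x => (Q x).toReal) m fun U => iidE (fun x => (P x).toReal) m fun Z =>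
          err T U Z) = (iidE (fun x => (P x).toReal) m fun T =>
        iidE (fun x => (Q x).toReal) m fun U => iidE (fun x => (P x).toReal) m fun Z =>
          1 + (-δ⁻¹) * err T U Z) := by
      simp only [iidE_add, iidE_const_mul, iidE_const P.sum_toReal, iidE_const Q.sum_toReal]
    refine le_trans ?_ (e.trans_le (iidE_mono hp fun T => iidE_mono hr fun U =>
      iidE_mono hp fun Z => ?_))
    · have := mul_le_mul_of_nonneg_left h (inv_nonneg.2 hδ.le)
      have e2 : δ⁻¹ * (δ / 3) = 1 / 3 := by field_simp
      linarith
    · have := mul_nonneg (inv_nonneg.2 hδ.le) (h0 T U Z)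
      split_ifs with hle
      · linarith
      · have := mul_le_mul_of_nonneg_left (not_le.1 hle).le (inv_nonneg.2 hδ.le)
        rw [inv_mul_cancel₀ hδ.ne'] at this
        linarith
  let good : Finset ((Fin m → Fin n → Fin q) × (Fin m → Fin n → Fin q) × (Fin m → Fin n → Fin q)) :=
    Finset.univ.filter fun z => err z.1 z.2.1 z.2.2 ≤ δ
  -- A finite disjoint union of cylinders inside the event suffices for a lower bound; measurability
  -- of the event itself is not needed.
  have h2 : (⋃ z ∈ good, cylinder z.1 z.2.1 z.2.2) ⊆
      {ω : Tape n q | err (fun t => ω.1 t) (fun t => ω.2.1 t) (fun t => ω.1 (m + t)) ≤ δ} := by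
    intro ω hω
    simp only [Set.mem_iUnion] at hω
    obtain ⟨z, hz, hω⟩ := hω
    obtain ⟨e1, e2, e3⟩ := mem_cylinder.1 hω
    have := (Finset.mem_filter.1 hz).2
    rwa [e1, e2, e3] at this
  refine le_trans ?_ (measure_mono h2)
  rw [measure_biUnion_finset]
  · simp only [tapeLaw_cylinder]
    rw [← ENNReal.ofReal_sum_of_nonneg]
    · have e : (2 / 3 : ENNReal) = ENNReal.ofReal (2 / 3) := by
        rw [ENNReal.ofReal_div_of_pos (by norm_num)]
        simp
      rw [e]
      refine ENNReal.ofReal_le_ofReal (h1.trans (le_of_eq ?_))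
      simp only [iidE, Finset.mul_sum]
      rw [Finset.sum_filter, Fintype.sum_prod_type]
      refine Finset.sum_congr rfl fun T _ => ?_
      rw [Fintype.sum_prod_type]
      refine Finset.sum_congr rfl fun U _ => Finset.sum_congr rfl fun Z _ => ?_
      split_ifs <;> simp
    · intro z _
      exact mul_nonneg (Finset.prod_nonneg fun _ _ => hp _) (mul_nonneg
        (Finset.prod_nonneg fun _ _ => hr _)
        (mul_nonneg (Finset.prod_nonneg fun _ _ => hp _) zero_le_one))
  · intro z _ z' _ hne
    refine Set.disjoint_left.2 fun ω h h' => hne ?_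
    obtain ⟨e1, e2, e3⟩ := mem_cylinder.1 h
    obtain ⟨e1', e2', e3'⟩ := mem_cylinder.1 h'
    exact Prod.ext (e1.trans e1'.symm) (Prod.ext (e2.trans e2'.symm) (e3.trans e3'.symm))
  · exact fun z _ => measurableSet_cylinder _ _ _

end RealRAM

/-! ### Reasoning about programs -/

namespace RealRAM

theorem State.setN_nreg (s : State) (r v r' : ℕ) :
    (s.setN r v).nreg r' = if r' = r then v else s.nreg r' := Function.update_apply _ _ _ _
theorem State.setN_narr (s : State) (r v : ℕ) : (s.setN r v).narr = s.narr := rfl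
theorem State.setN_rreg (s : State) (r v : ℕ) : (s.setN r v).rreg = s.rreg := rfl
theorem State.setN_draws (s : State) (r v : ℕ) : (s.setN r v).draws = s.draws := rfl
theorem State.setN_time (s : State) (r v : ℕ) : (s.setN r v).time = s.time := rfl
theorem State.setR_nreg (s : State) (r : ℕ) (v : ℝ) : (s.setR r v).nreg = s.nreg := rfl
theorem State.setR_narr (s : State) (r : ℕ) (v : ℝ) : (s.setR r v).narr = s.narr := rfl
theorem State.setR_rreg (s : State) (r : ℕ) (v : ℝ) (r' : ℕ) :
    (s.setR r v).rreg r' = if r' = r then v else s.rreg r' := Function.update_apply _ _ _ _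
theorem State.setR_draws (s : State) (r : ℕ) (v : ℝ) : (s.setR r v).draws = s.draws := rfl
theorem State.setR_time (s : State) (r : ℕ) (v : ℝ) : (s.setR r v).time = s.time := rfl
theorem State.tick_nreg (s : State) (t : ℕ) : (s.tick t).nreg = s.nreg := rfl
theorem State.tick_narr (s : State) (t : ℕ) : (s.tick t).narr = s.narr := rfl
theorem State.tick_rreg (s : State) (t : ℕ) : (s.tick t).rreg = s.rreg := rfl
theorem State.tick_draws (s : State) (t : ℕ) : (s.tick t).draws = s.draws := rfl
theorem State.tick_time (s : State) (t : ℕ) : (s.tick t).time = s.time + t := rfl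

attribute [simp] State.setN_nreg State.setN_narr State.setN_rreg State.setN_draws State.setN_time
  State.setR_nreg State.setR_narr State.setR_rreg State.setR_draws State.setR_time
  State.tick_nreg State.tick_narr State.tick_rreg State.tick_draws State.tick_time

infixr:67 " ;; " => Cmd.seq

variable {n q : ℕ} {ω : Tape n q}

/-- Started in `s`, the program `c` halts in a state that satisfies `Φ`. -/
def Runs (ω : Tape n q) (c : Cmd) (s : State) (Φ : State → Prop) : Prop :=
  ∃ s', Exec ω c s s' ∧ Φ s'

theorem runs_op {o : Op} {s : State} {Φ : State → Prop} :
    Runs ω (.op o) s Φ ↔ Φ ((o.effect ω s).tick (o.cost n)) := by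
  constructor
  · rintro ⟨s', h, hΦ⟩
    cases h
    exact hΦ
  · exact fun h => ⟨_, .op o s, h⟩

theorem runs_seq {c₁ c₂ : Cmd} {s : State} {Φ : State → Prop} :
    Runs ω (c₁ ;; c₂) s Φ ↔ Runs ω c₁ s fun s' => Runs ω c₂ s' Φ := by
  constructor
  · rintro ⟨s', h, hΦ⟩
    cases h with
    | seq h₁ h₂ => exact ⟨_, h₁, _, h₂, hΦ⟩
  · rintro ⟨s', h₁, s'', h₂, hΦ⟩
    exact ⟨s'', .seq h₁ h₂, hΦ⟩

open Classical in
theorem runs_branch {t : Test} {c₁ c₂ : Cmd} {s : State} {Φ : State → Prop} :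
    Runs ω (.branch t c₁ c₂) s Φ ↔
      if t.holds s then Runs ω c₁ (s.tick 1) Φ else Runs ω c₂ (s.tick 1) Φ := by
  constructor
  · rintro ⟨s', h, hΦ⟩
    cases h with
    | branch_true ht h => rw [if_pos ht]; exact ⟨_, h, hΦ⟩
    | branch_false ht h => rw [if_neg ht]; exact ⟨_, h, hΦ⟩
  · intro h
    split_ifs at h with ht
    · obtain ⟨s', h, hΦ⟩ := h
      exact ⟨s', .branch_true ht h, hΦ⟩
    · obtain ⟨s', h, hΦ⟩ := h
      exact ⟨s', .branch_false ht h, hΦ⟩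

/-- The execution itself is handed to the consequence, so that frame facts can be extracted from it
alongside the postcondition. -/
theorem Runs.mono {c : Cmd} {s : State} {Φ Ψ : State → Prop} (h : Runs ω c s Φ)
    (hΨ : ∀ s', Exec ω c s s' → Φ s' → Ψ s') : Runs ω c s Ψ :=
  let ⟨s', he, hΦ⟩ := h
  ⟨s', he, hΨ s' he hΦ⟩

/-! #### Frames -/

/-- Every instruction of the program satisfies `p`. -/
def Cmd.all (p : Op → Bool) : Cmd → Bool
  | .op o => p o
  | .seq c₁ c₂ => c₁.all p && c₂.all p
  | .branch _ c₁ c₂ => c₁.all p && c₂.all p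
  | .loop _ c => c.all p

/-- The instruction does not write the register `r` of naturals. -/
def Op.keepsN (r : ℕ) : Op → Bool
  | .const r' _ | .add r' _ _ | .sub r' _ _ | .load r' _ _ | .flip r' => !(r == r')
  | _ => true

/-- The instruction does not write the register `r` of reals. -/
def Op.keepsR (r : ℕ) : Op → Bool
  | .cast r' _ | .radd r' _ _ | .rsub r' _ _ | .rmul r' _ _ | .rdiv r' _ _ | .rload r' _ _ =>
    !(r == r')
  | _ => true

/-- The instruction does not write the array `A` of naturals. -/
def Op.keepsA (A : ℕ) : Op → Bool
  | .store A' _ _ | .draw _ A' => !(A == A')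
  | _ => true

/-- The instruction draws no sample. -/
def Op.keepsD : Op → Bool
  | .draw _ _ => false
  | _ => true

/-- `s'` agrees with `s` on everything that `c` does not write. -/
structure Keeps (c : Cmd) (s s' : State) : Prop where
  nreg : ∀ r, c.all (Op.keepsN r) → s'.nreg r = s.nreg r
  rreg : ∀ r, c.all (Op.keepsR r) → s'.rreg r = s.rreg r
  narr : ∀ A, c.all (Op.keepsA A) → s'.narr A = s.narr A
  draws : c.all Op.keepsD → s'.draws = s.draws

/-- One induction serves all four kinds of frame condition. As the test on the program is Boolean,
frames of concrete programs hold by computation. -/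
theorem Exec.eq_of_all {β : Type*} {p : Op → Bool} {f : State → β}
    (hp : ∀ o s, p o → f (o.effect ω s) = f s) (ht : ∀ s t, f (s.tick t) = f s)
    {c : Cmd} {s s' : State} (h : Exec ω c s s') (hc : c.all p) : f s' = f s := by
  induction h with
  | op o s => rw [ht, hp o s hc]
  | seq _ _ ih₁ ih₂ =>
    simp only [Cmd.all, Bool.and_eq_true] at hc
    rw [ih₂ hc.2, ih₁ hc.1]
  | branch_true _ _ ih =>
    simp only [Cmd.all, Bool.and_eq_true] at hc
    rw [ih hc.1, ht]
  | branch_false _ _ ih =>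
    simp only [Cmd.all, Bool.and_eq_true] at hc
    rw [ih hc.2, ht]
  | loop_true _ _ _ ih₁ ih₂ => rw [ih₂ hc, ih₁ hc, ht]
  | loop_false _ => rw [ht]

theorem Exec.keeps {c : Cmd} {s s' : State} (h : Exec ω c s s') : Keeps c s s' where
  nreg r := h.eq_of_all (f := fun s => s.nreg r)
    (fun o s ho => by cases o <;> simp_all [Op.effect, Op.keepsN]) fun _ _ => rfl
  rreg r := h.eq_of_all (f := fun s => s.rreg r)
    (fun o s ho => by cases o <;> simp_all [Op.effect, Op.keepsR]) fun _ _ => rfl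
  narr A := h.eq_of_all (f := fun s => s.narr A)
    (fun o s ho => by cases o <;> simp_all [Op.effect, Op.keepsA]) fun _ _ => rfl
  draws := h.eq_of_all (f := fun s => s.draws)
    (fun o s ho => by cases o <;> simp_all [Op.effect, Op.keepsD]) fun _ _ => rfl

theorem Keeps.refl (c : Cmd) (s : State) : Keeps c s s :=
  ⟨fun _ _ => rfl, fun _ _ => rfl, fun _ _ => rfl, fun _ => rfl⟩

theorem Keeps.trans {c : Cmd} {s s' s'' : State} (h : Keeps c s s') (h' : Keeps c s' s'') :
    Keeps c s s'' :=
  ⟨fun r hr => (h'.nreg r hr).trans (h.nreg r hr), fun r hr => (h'.rreg r hr).trans (h.rreg r hr),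
    fun r hr => (h'.narr r hr).trans (h.narr r hr), fun hr => (h'.draws hr).trans (h.draws hr)⟩

/-! #### Loops -/

/-- The exact number `N` of iterations is supplied in advance, so termination comes with the
invariant, by induction on the iterations left. The frame of the body is available at each iteration
and need not be part of `I`. -/
theorem Runs.loop {t : Test} {c : Cmd} {s : State} {Φ : State → Prop} (N : ℕ)
    (I : ℕ → State → Prop) (h0 : I 0 s)
    (step : ∀ k < N, ∀ s', Keeps c s s' → I k s' → t.holds s' ∧ Runs ω c (s'.tick 1) (I (k + 1)))
    (h_end : ∀ s', Keeps c s s' → I N s' → ¬ t.holds s' ∧ Φ (s'.tick 1)) :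
    Runs ω (.loop t c) s Φ := by
  have key : ∀ j, ∀ s', j ≤ N → Keeps c s s' → I (N - j) s' → Runs ω (.loop t c) s' Φ := by
    intro j
    induction j with
    | zero =>
      intro s' _ hk hI
      obtain ⟨ht, hΦ⟩ := h_end s' hk hI
      exact ⟨_, .loop_false ht, hΦ⟩
    | succ j ih =>
      intro s' hj hk hI
      obtain ⟨ht, s'', he, hI'⟩ := step (N - (j + 1)) (by omega) s' hk hI
      have hk' : Keeps c s s'' := hk.trans
        ⟨he.keeps.nreg, he.keeps.rreg, he.keeps.narr, he.keeps.draws⟩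
      rw [show N - (j + 1) + 1 = N - j by omega] at hI'
      obtain ⟨s₃, he', hΦ⟩ := ih s'' (by omega) hk' hI'
      exact ⟨s₃, .loop_true ht he he', hΦ⟩
  exact key N s le_rfl (.refl c s) (by simpa using h0)

/-- `for x_i = 0, …, x_N - 1 do c`, where the register `3` holds the number `1`. -/
def Cmd.for (i N : ℕ) (c : Cmd) : Cmd :=
  .op (.const i 0) ;; .loop (.lt i N) (c ;; .op (.add i i 3))

/-- Each iteration adds 2 steps for test and increment, and the loop adds 2 for the initialization
and the failing test. The hypothesis `hI` makes the invariant insensitive to counter and clock,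
which the loop itself changes. -/
theorem Runs.for {i N : ℕ} {c : Cmd} {s : State} (I : ℕ → State → Prop) (B : ℕ)
    (hone : s.nreg 3 = 1) (hc : c.all (Op.keepsN 3) ∧ c.all (Op.keepsN i) ∧ c.all (Op.keepsN N))
    (hiN : i ≠ N) (hi3 : i ≠ 3)
    (hI : ∀ k s' v t, I k s' → I k ((s'.setN i v).tick t)) (h0 : I 0 s)
    (step : ∀ k < s.nreg N, ∀ s', Keeps (.for i N c) s s' → s'.nreg i = k → I k s' →
      Runs ω c s' fun s'' => I (k + 1) s'' ∧ s''.time ≤ s'.time + B) :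
    Runs ω (.for i N c) s fun s' =>
      I (s.nreg N) s' ∧ s'.time ≤ s.time + s.nreg N * (B + 2) + 2 := by
  rw [Cmd.for, runs_seq, runs_op]
  have hlift : ∀ s', Keeps (c ;; .op (.add i i 3)) ((Op.effect ω s (.const i 0)).tick 1) s' →
      Keeps (.for i N c) s s' := fun s' hk => by
    refine ⟨fun r hr => ?_, fun r hr => ?_, fun r hr => ?_, fun hr => ?_⟩
    · simp only [Cmd.for, Cmd.all, Bool.and_eq_true] at hr
      rw [hk.nreg r (by simpa [Cmd.all] using hr.2)]
      have : r ≠ i := by simpa [Op.keepsN] using hr.1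
      simp [Op.effect, this]
    · simp only [Cmd.for, Cmd.all, Bool.and_eq_true] at hr
      rw [hk.rreg r (by simpa [Cmd.all] using hr.2)]
      simp [Op.effect]
    · simp only [Cmd.for, Cmd.all, Bool.and_eq_true] at hr
      rw [hk.narr r (by simpa [Cmd.all] using hr.2)]
      simp [Op.effect]
    · simp only [Cmd.for, Cmd.all, Bool.and_eq_true] at hr
      rw [hk.draws (by simpa [Cmd.all] using hr.2)]
      simp [Op.effect]
  have h3 : (Cmd.for i N c).all (Op.keepsN 3) := by
    simp [Cmd.for, Cmd.all, hc, Op.keepsN, hi3.symm]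
  have hN : (Cmd.for i N c).all (Op.keepsN N) := by
    simp [Cmd.for, Cmd.all, hc, Op.keepsN, hiN.symm]
  refine Runs.loop (s.nreg N)
    (fun k s' => I k s' ∧ s'.nreg i = k ∧ s'.time ≤ s.time + 1 + k * (B + 2))
    ⟨hI _ _ _ _ h0, by simp [Op.effect], by simp [Op.effect, Op.cost]⟩ ?_ ?_
  · intro k hk s' hkeep ⟨hIk, hik, ht⟩
    have hks := hlift s' hkeep
    refine ⟨by simpa [Test.holds, hik, hks.nreg N hN] using hk, ?_⟩
    rw [runs_seq]
    have hks' : Keeps (.for i N c) s (s'.tick 1) := ⟨hks.nreg, hks.rreg, hks.narr, hks.draws⟩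
    have hIk' : I k (s'.tick 1) := by
      -- Writing the counter's own value back brings a pure tick into the form covered by `hI`.
      have : s'.tick 1 = (s'.setN i (s'.nreg i)).tick 1 := by
        simp [State.tick, State.setN]
      rw [this]
      exact hI _ _ _ _ hIk
    refine (step k hk _ hks' hik hIk').mono fun s'' he ⟨hI'', ht''⟩ => ?_
    rw [runs_op]
    refine ⟨hI _ _ _ _ hI'', ?_, ?_⟩
    · have h1 := he.keeps.nreg i hc.2.1
      have h2 := he.keeps.nreg 3 hc.1
      simp only [State.tick_nreg] at h1 h2
      simp [Op.effect, h1, h2, hik, hks.nreg 3 h3, hone]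
    · simp only [Op.effect, Op.cost, State.tick_time, State.setN_time] at ht'' ⊢
      rw [add_mul, one_mul]
      omega
  · intro s' hkeep ⟨hIk, hik, ht⟩
    have hks := hlift s' hkeep
    refine ⟨by simp [Test.holds, hik, hks.nreg N hN], ?_, ?_⟩
    · have : s'.tick 1 = (s'.setN i (s'.nreg i)).tick 1 := by
        simp [State.tick, State.setN]
      rw [this]
      exact hI _ _ _ _ hIk
    · simp only [State.tick_time]
      omega

end RealRAM

/-! ### The program and its parts -/

namespace RealRAM

/-- A sequence of instructions. -/
def Cmd.block : Op → List Op → Cmd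
  | o, [] => .op o
  | o, o' :: l => .op o ;; .block o' l

/-- `x_8 :=` the code of the values of the parents of the node `x_6`, for the sample in array `3`;
the list of the parents starts in cell `x_13`. -/
def codeCmd (b : Bool) : Cmd :=
  .block (.load 11 (6 + b.toNat) 6) [.const 8 0] ;;
  .for 7 11 (.block (.add 10 13 7)
    [.load 10 (4 + b.toNat) 10, .load 10 3 10, .load 8 2 8, .add 8 8 10])

/-- Run `hook` for every node, with the address of the values of the parents in `x_8` and the
address of the values of the node and its parents in `x_14`. -/
def nodeLoop (b : Bool) (hook : Cmd) : Cmd :=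
  .block (.const 9 0) [.const 13 0] ;;
  .for 6 0 (codeCmd b ;;
    .block (.load 14 2 8) [.load 10 3 6, .add 14 14 10, .add 8 9 8, .add 14 9 14] ;;
    hook ;; .block (.add 9 9 4) [.add 13 13 0])

/-- Count an occurrence. -/
def countHook (b : Bool) : Cmd :=
  .block (.load 10 (8 + b.toNat) 8) [.add 10 10 3, .store (8 + b.toNat) 8 10,
    .load 10 (10 + b.toNat) 14, .add 10 10 3, .store (10 + b.toNat) 14 10]

/-- Multiply `y_5` or `y_6` by an estimated local factor. -/
def evalHook (b : Bool) : Cmd :=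
  .block (.load 10 (10 + b.toNat) 14) [.add 10 10 3, .cast 12 10, .load 10 (8 + b.toNat) 8,
    .add 10 10 1, .cast 13 10, .rdiv 12 12 13, .rmul (5 + b.toNat) (5 + b.toNat) 12]

/-- The list of the parents of the node `i`. -/
noncomputable def parentList {n : ℕ} (G : Digraph (Fin n)) (i : ℕ) : List ℕ :=
  (List.range n).filter fun j => adjCells G (j * n + i) = 1

/-- The number with digits `X j` in base `q`, for the indices `j` in a list. -/
def code (q : ℕ) (X : ℕ → ℕ) (L : List ℕ) : ℕ :=
  L.foldl (fun c j => q * c + X j) 0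

theorem code_append_singleton (q : ℕ) (X : ℕ → ℕ) (L : List ℕ) (j : ℕ) :
    code q X (L ++ [j]) = q * code q X L + X j := by
  simp [code]

theorem code_congr {q : ℕ} {X Y : ℕ → ℕ} {L : List ℕ} (h : ∀ j ∈ L, X j = Y j) :
    code q X L = code q Y L := by
  induction L using List.reverseRecOn with
  | nil => rfl
  | append_singleton L j ih =>
    rw [code_append_singleton, code_append_singleton, h j (by simp),
      ih fun k hk => h k (by simp [hk])]

theorem code_lt {q : ℕ} {X : ℕ → ℕ} {L : List ℕ} (h : ∀ j ∈ L, X j < q) :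
    code q X L < q ^ L.length := by
  induction L using List.reverseRecOn with
  | nil => simp [code]
  | append_singleton L j ih =>
    have h1 := h j (by simp)
    have h2 := ih fun k hk => h k (by simp [hk])
    rw [code_append_singleton, List.length_append, List.length_singleton, pow_succ]
    nlinarith

/-- Digits below q are recovered from the last one by reduction modulo q. Distinct parent
configurations therefore use distinct counters. -/
theorem code_inj {q : ℕ} {X Y : ℕ → ℕ} {L : List ℕ} (hX : ∀ j ∈ L, X j < q)
    (hY : ∀ j ∈ L, Y j < q) (h : code q X L = code q Y L) : ∀ j ∈ L, X j = Y j := by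
  induction L using List.reverseRecOn with
  | nil => simp
  | append_singleton L j ih =>
    rw [code_append_singleton, code_append_singleton] at h
    have h1 := hX j (by simp)
    have h2 := hY j (by simp)
    have hm : X j = Y j := by
      have := congrArg (· % q) h
      simpa [Nat.mul_add_mod, Nat.mod_eq_of_lt h1, Nat.mod_eq_of_lt h2] using this
    have hc : code q X L = code q Y L := by
      rw [hm] at h
      exact Nat.eq_of_mul_eq_mul_left (by omega) (Nat.add_right_cancel h)
    intro k hk
    rcases List.mem_append.1 hk with hk | hk
    · exact ih (fun k hk => hX k (by simp [hk])) (fun k hk => hY k (by simp [hk])) hc k hk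
    · rw [List.mem_singleton.1 hk, hm]

variable {n q : ℕ} {ω : Tape n q}

/-- The tables that the program needs for processing samples. -/
structure Tables (q d : ℕ) (G : Bool → Digraph (Fin n)) (s : State) : Prop where
  n_eq : s.nreg 0 = n
  q_eq : s.nreg 1 = q
  one_eq : s.nreg 3 = 1
  stride_eq : s.nreg 4 = q ^ (d + 1)
  mul_eq : ∀ k < q ^ (d + 1), s.narr 2 k = q * k
  length_eq : ∀ b, ∀ i < n, s.narr (6 + b.toNat) i = (parentList (G b) i).length
  list_eq : ∀ b, ∀ i < n, (List.range (parentList (G b) i).length).map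
    (fun r => s.narr (4 + b.toNat) (i * n + r)) = parentList (G b) i

theorem Tables.of_keeps {d : ℕ} {G : Bool → Digraph (Fin n)} {s s' : State} {c : Cmd}
    (h : Tables q d G s) (hk : Keeps c s s')
    (hc : (c.all (Op.keepsN 0) && c.all (Op.keepsN 1) && c.all (Op.keepsN 3) &&
      c.all (Op.keepsN 4) && c.all (Op.keepsA 2) && c.all (Op.keepsA 4) && c.all (Op.keepsA 5) &&
      c.all (Op.keepsA 6) && c.all (Op.keepsA 7)) = true) : Tables q d G s' := by
  simp only [Bool.and_eq_true] at hc
  obtain ⟨⟨⟨⟨⟨⟨⟨⟨h0, h1⟩, h3⟩, h4⟩, a2⟩, a4⟩, a5⟩, a6⟩, a7⟩ := hc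
  refine ⟨(hk.nreg _ h0).trans h.n_eq, (hk.nreg _ h1).trans h.q_eq, (hk.nreg _ h3).trans h.one_eq,
    (hk.nreg _ h4).trans h.stride_eq, ?_, ?_, ?_⟩
  · rw [hk.narr _ a2]
    exact h.mul_eq
  · intro b i hi
    rw [← h.length_eq b i hi]
    cases b
    · rw [hk.narr (6 + false.toNat) a6]
    · rw [hk.narr (6 + true.toNat) a7]
  · intro b i hi
    refine Eq.trans ?_ (h.list_eq b i hi)
    cases b
    · rw [hk.narr (4 + false.toNat) a4]
    · rw [hk.narr (4 + true.toNat) a5]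

theorem parentList_lt {G : Digraph (Fin n)} {i j : ℕ} (h : j ∈ parentList G i) : j < n := by
  simp only [parentList, List.mem_filter, List.mem_range] at h
  exact h.1

/-- Horner's scheme, where multiplication by q is a lookup in array `2`; the partial codes have to
stay below the table size q^(d+1). Each parent costs 5 instructions and 2 steps of loop overhead. -/
theorem runs_codeCmd {d : ℕ} {G : Bool → Digraph (Fin n)} {s : State} (hs : Tables q d G s)
    (b : Bool) {i : ℕ} (hi : i < n) (hd : (parentList (G b) i).length ≤ d)
    (hX : ∀ j < n, s.narr 3 j < q) (h6 : s.nreg 6 = i) (h13 : s.nreg 13 = i * n) :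
    Runs ω (codeCmd b) s fun s' => s'.nreg 8 = code q (s.narr 3) (parentList (G b) i) ∧
      s'.time ≤ s.time + (7 * d + 4) := by
  rw [codeCmd, Cmd.block, Cmd.block, runs_seq, runs_seq, runs_op, runs_op]
  set L := parentList (G b) i with hL
  have hLget := hs.list_eq b i hi
  have hpre : ∀ k, k < L.length → (List.range (k + 1)).map
      (fun r => s.narr (4 + b.toNat) (i * n + r)) = (List.range k).map
      (fun r => s.narr (4 + b.toNat) (i * n + r)) ++ [s.narr (4 + b.toNat) (i * n + k)] :=
    fun k _ => by rw [List.range_succ, List.map_append]; rfl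
  have hmem : ∀ k, k < L.length → s.narr (4 + b.toNat) (i * n + k) ∈ L := fun k hk => by
    rw [hL, ← hLget]
    exact List.mem_map.2 ⟨k, List.mem_range.2 hk, rfl⟩
  refine (Runs.for (fun k s' => s'.nreg 8 = code q (s.narr 3)
    ((List.range k).map fun r => s.narr (4 + b.toNat) (i * n + r))) 5 ?_ ?_ (by decide) (by decide)
    ?_ ?_ ?_).mono ?_
  · simp [Op.effect, hs.one_eq]
  · cases b <;> decide
  · intro k s' v t h
    simpa using h
  · simp [Op.effect, code]
  · intro k hk s' hkeep h7 h8
    simp [Op.effect, h6, hs.length_eq b i hi] at hk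
    rw [← hL] at hk
    have e13 : s'.nreg 13 = i * n := by
      rw [hkeep.nreg 13 (by cases b <;> decide)]
      simpa [Op.effect] using h13
    have eA : ∀ A, s'.narr A = s.narr A := fun A => by
      rw [hkeep.narr A (by cases b <;> rfl)]
      simp [Op.effect]
    have hlt : code q (s.narr 3)
        ((List.range k).map fun r => s.narr (4 + b.toNat) (i * n + r)) < q ^ (d + 1) := by
      have hq : 0 < q := lt_of_le_of_lt (Nat.zero_le _) (hX i hi)
      refine (code_lt fun j hj => ?_).trans_le (Nat.pow_le_pow_right hq ?_)
      · obtain ⟨r, hr, rfl⟩ := List.mem_map.1 hj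
        exact hX _ (parentList_lt (hmem r ((List.mem_range.1 hr).trans hk)))
      · simp
        omega
    simp [Cmd.block, runs_seq, runs_op, Op.effect, Op.cost, e13, h7, h8, eA, hs.mul_eq _ hlt,
      hpre k hk, code_append_singleton]
  · rintro s' - ⟨h1, h2⟩
    simp only [Op.effect, Op.cost, State.tick_nreg, State.setN_nreg, State.tick_time,
      State.setN_time, h6, hs.length_eq b i hi] at h1 h2
    rw [← hL] at h1 h2
    norm_num at h1 h2
    rw [hLget] at h1
    refine ⟨h1, ?_⟩
    nlinarith

/-- The address of the values of the parents of node `i`. -/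
noncomputable def parentAddr (G : Digraph (Fin n)) (q d : ℕ) (X : ℕ → ℕ) (i : ℕ) : ℕ :=
  i * q ^ (d + 1) + code q X (parentList G i)

/-- The address of the values of node `i` and its parents. -/
noncomputable def familyAddr (G : Digraph (Fin n)) (q d : ℕ) (X : ℕ → ℕ) (i : ℕ) : ℕ :=
  i * q ^ (d + 1) + (q * code q X (parentList G i) + X i)

/-- Shared by counting and evaluation. The offsets i q^(d+1) and i n are maintained by addition. The
bookkeeping changes only natural registers, so `J` is required to depend on natural arrays and real
registers alone. A node costs 7d + 4 for the code, 5 for the addresses, 8 for the hook and 2 for the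
offsets, plus the loop overhead. -/
theorem runs_nodeLoop {d : ℕ} {G : Bool → Digraph (Fin n)} {s : State} (hs : Tables q d G s)
    (b : Bool) (hd : ∀ i < n, (parentList (G b) i).length ≤ d) (hX : ∀ j < n, s.narr 3 j < q)
    (hook : Cmd) (hook_keeps : (hook.all (Op.keepsN 0) && hook.all (Op.keepsN 1) &&
      hook.all (Op.keepsN 3) && hook.all (Op.keepsN 4) && hook.all (Op.keepsN 6) &&
      hook.all (Op.keepsN 9) && hook.all (Op.keepsN 13) && hook.all (Op.keepsA 2) &&
      hook.all (Op.keepsA 3) && hook.all (Op.keepsA 4) && hook.all (Op.keepsA 5) &&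
      hook.all (Op.keepsA 6) && hook.all (Op.keepsA 7)) = true)
    (J : ℕ → State → Prop)
    (hJ : ∀ k s s', s'.narr = s.narr → s'.rreg = s.rreg → J k s → J k s') (h0 : J 0 s)
    (hstep : ∀ i < n, ∀ s', s'.nreg 1 = q → s'.nreg 3 = 1 →
      s'.nreg 8 = parentAddr (G b) q d (s.narr 3) i →
      s'.nreg 14 = familyAddr (G b) q d (s.narr 3) i → J i s' →
      Runs ω hook s' fun s'' => J (i + 1) s'' ∧ s''.time ≤ s'.time + 8) :
    Runs ω (nodeLoop b hook) s fun s' => J n s' ∧ s'.time ≤ s.time + (n * (7 * d + 21) + 4) := by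
  simp only [Bool.and_eq_true] at hook_keeps
  obtain ⟨⟨⟨⟨⟨⟨⟨⟨⟨⟨⟨⟨k0, k1⟩, k3⟩, k4⟩, k6⟩, k9⟩, k13⟩, a2⟩, a3⟩, a4⟩, a5⟩, a6⟩, a7⟩ := hook_keeps
  have c0 : ∀ r ∈ [0, 1, 3, 4, 6, 9, 13], (codeCmd b).all (Op.keepsN r) := by
    cases b <;> decide
  have cA : ∀ A, (codeCmd b).all (Op.keepsA A) := fun A => by cases b <;> rfl
  have cR : ∀ A, (codeCmd b).all (Op.keepsR A) := fun A => by cases b <;> rfl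
  simp only [List.forall_mem_cons] at c0
  obtain ⟨c0, c1, c3, c4, c6, c9, c13, -⟩ := c0
  rw [nodeLoop, Cmd.block, Cmd.block, runs_seq, runs_seq, runs_op, runs_op]
  refine (Runs.for (fun k s' => s'.nreg 9 = k * q ^ (d + 1) ∧ s'.nreg 13 = k * n ∧ J k s')
    (7 * d + 19) ?_ ?_ (by decide) (by decide) ?_ ?_ ?_).mono ?_
  · simp [Op.effect, hs.one_eq]
  · simp [Cmd.all, Cmd.block, k0, k3, k6, c0, c3, c6, Op.keepsN]
  · intro k s' v t ⟨h1, h2, h3⟩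
    exact ⟨by simpa using h1, by simpa using h2, hJ k s' _ rfl rfl h3⟩
  · exact ⟨by simp [Op.effect], by simp [Op.effect], hJ 0 s _ rfl rfl h0⟩
  · intro i hi s' hkeep h6 ⟨h9, h13, hJi⟩
    have hi : i < n := by simpa [Op.effect, hs.n_eq] using hi
    have e3 : s'.narr 3 = s.narr 3 := by
      rw [hkeep.narr 3 (by simp [Cmd.for, Cmd.all, Cmd.block, Op.keepsA, a3, cA])]
      simp [Op.effect]
    have hs' : Tables q d G s' := by
      have hs0 : Tables q d G ((Op.effect ω ((Op.effect ω s (.const 9 0)).tick (Op.cost n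
          (.const 9 0))) (.const 13 0)).tick (Op.cost n (.const 13 0))) :=
        hs.of_keeps (Exec.seq (Exec.op _ _) (Exec.op _ _)).keeps rfl
      refine hs0.of_keeps hkeep ?_
      simp [Cmd.for, Cmd.all, Cmd.block, Op.keepsA, Op.keepsN, c0, c1, c3, c4, k0, k1, k3, k4, a2,
        a4, a5, a6, a7, cA]
    rw [runs_seq]
    refine (runs_codeCmd hs' b hi (hd i hi) (by rwa [e3]) h6 h13).mono fun s₁ he₁ ⟨h8, ht₁⟩ => ?_
    have hs₁ : Tables q d G s₁ := hs'.of_keeps he₁.keeps (by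
      simp [c0, c1, c3, c4, cA])
    have eA₁ : ∀ A, s₁.narr A = s'.narr A := fun A => he₁.keeps.narr A (cA A)
    have eR₁ : s₁.rreg = s'.rreg := funext fun A => he₁.keeps.rreg A (cR A)
    have e6₁ := (he₁.keeps.nreg 6 c6).trans h6
    have e9₁ := (he₁.keeps.nreg 9 c9).trans h9
    have e13₁ := (he₁.keeps.nreg 13 c13).trans h13
    rw [e3] at h8
    have hq : 0 < q := lt_of_le_of_lt (Nat.zero_le _) (hX i hi)
    have hlt : code q (s.narr 3) (parentList (G b) i) < q ^ (d + 1) :=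
      (code_lt fun j hj => hX j (parentList_lt hj)).trans_le
        (Nat.pow_le_pow_right hq ((hd i hi).trans (Nat.le_succ d)))
    have hmul : s'.narr 2 (code q (s.narr 3) (parentList (G b) i)) =
        q * code q (s.narr 3) (parentList (G b) i) := hs'.mul_eq _ hlt
    simp only [Cmd.block, runs_seq, runs_op]
    refine (hstep i hi _ ?_ ?_ ?_ ?_ ?_).mono fun s₂ he₂ ⟨hJ₂, ht₂⟩ => ?_
    · simp [Op.effect, hs₁.q_eq]
    · simp [Op.effect, hs₁.one_eq]
    · simp [Op.effect, e9₁, h8, parentAddr]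
    · simp [Op.effect, e9₁, h8, familyAddr, eA₁, hmul, e6₁, e3]
    · exact hJ i s' _ (funext fun A => by simp [Op.effect, eA₁]) (by simpa [Op.effect, State.setN, State.tick] using eR₁) hJi
    · have f9 := he₂.keeps.nreg 9 k9
      have f4 := he₂.keeps.nreg 4 k4
      have f13 := he₂.keeps.nreg 13 k13
      have f0 := he₂.keeps.nreg 0 k0
      simp [Op.effect, e9₁, e13₁, hs₁.stride_eq, hs₁.n_eq] at f9 f4 f13 f0
      refine ⟨⟨?_, ?_, hJ _ s₂ _ rfl rfl hJ₂⟩, ?_⟩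
      · simp [Op.effect, f9, f4, add_mul]
      · simp [Op.effect, f13, f0, add_mul]
      · simp [Op.effect, Op.cost] at ht₂ ⊢
        omega
  · rintro s' - ⟨⟨-, -, h1⟩, h2⟩
    simp only [Op.effect, Op.cost, State.tick_nreg, State.setN_nreg, State.tick_time,
      State.setN_time, hs.n_eq] at h1 h2
    norm_num [hs.n_eq] at h1 h2
    refine ⟨h1, ?_⟩
    linarith

theorem runs_count {d : ℕ} {G : Bool → Digraph (Fin n)} {s : State} (hs : Tables q d G s)
    (b : Bool) (hd : ∀ i < n, (parentList (G b) i).length ≤ d) (hX : ∀ j < n, s.narr 3 j < q) :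
    Runs ω (nodeLoop b (countHook b)) s fun s' =>
      ((∀ c, s'.narr (8 + b.toNat) c = s.narr (8 + b.toNat) c +
        ∑ i ∈ Finset.range n, if parentAddr (G b) q d (s.narr 3) i = c then 1 else 0) ∧
      ∀ c, s'.narr (10 + b.toNat) c = s.narr (10 + b.toNat) c +
        ∑ i ∈ Finset.range n, if familyAddr (G b) q d (s.narr 3) i = c then 1 else 0) ∧
      s'.time ≤ s.time + (n * (7 * d + 21) + 4) := by
  refine runs_nodeLoop hs b hd hX _ (by cases b <;> decide) (fun k s' =>
    (∀ c, s'.narr (8 + b.toNat) c = s.narr (8 + b.toNat) c +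
        ∑ i ∈ Finset.range k, if parentAddr (G b) q d (s.narr 3) i = c then 1 else 0) ∧
      ∀ c, s'.narr (10 + b.toNat) c = s.narr (10 + b.toNat) c +
        ∑ i ∈ Finset.range k, if familyAddr (G b) q d (s.narr 3) i = c then 1 else 0) ?_ ?_ ?_
  · intro k s₁ s₂ h _ hk
    rwa [h]
  · simp
  · intro i hi s' h1 h3 h8 h14 ⟨hD, hN⟩
    simp only [Finset.sum_range_succ, countHook, Cmd.block, runs_seq, runs_op]
    have hne : ∀ a c : ℕ, (if a = c then 1 else 0) = if c = a then 1 else 0 := fun a c => by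
      simp only [eq_comm]
    cases b <;>
    · simp only [Op.effect, Op.cost, State.tick_nreg, State.tick_narr, State.setN_nreg,
        State.setN_narr, Function.update_apply, State.tick_time, State.setN_time, Bool.toNat_false,
        Bool.toNat_true] at *
      simp only [Nat.reduceAdd, add_zero] at hD hN ⊢
      norm_num [h3, h8, h14, -Finset.sum_boole, Function.update_apply]
      refine ⟨fun c => ?_, fun c => ?_⟩
      · rw [← add_assoc, ← hD, hne]
        split_ifs with h <;> simp [h]
      · rw [← add_assoc, ← hN, hne]
        split_ifs with h <;> simp [h]

/-- The estimated probability of the sample in array `3`. -/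
noncomputable def evalProd (G : Digraph (Fin n)) (q d : ℕ) (D N X : ℕ → ℕ) : ℝ :=
  ∏ i ∈ Finset.range n, ((N (familyAddr G q d X i) + 1 : ℕ) : ℝ) /
    ((D (parentAddr G q d X i) + q : ℕ) : ℝ)

theorem runs_eval {d : ℕ} {G : Bool → Digraph (Fin n)} {s : State} (hs : Tables q d G s)
    (b : Bool) (hd : ∀ i < n, (parentList (G b) i).length ≤ d) (hX : ∀ j < n, s.narr 3 j < q) :
    Runs ω (nodeLoop b (evalHook b)) s fun s' =>
      s'.rreg (5 + b.toNat) = s.rreg (5 + b.toNat) * evalProd (G b) q d (s.narr (8 + b.toNat))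
        (s.narr (10 + b.toNat)) (s.narr 3) ∧ s'.time ≤ s.time + (n * (7 * d + 21) + 4) := by
  refine (runs_nodeLoop hs b hd hX _ (by cases b <;> decide) (fun k s' =>
    s'.rreg (5 + b.toNat) = s.rreg (5 + b.toNat) *
      ∏ i ∈ Finset.range k,
        ((s.narr (10 + b.toNat) (familyAddr (G b) q d (s.narr 3) i) + 1 : ℕ) : ℝ) /
        ((s.narr (8 + b.toNat) (parentAddr (G b) q d (s.narr 3) i) + q : ℕ) : ℝ) ∧
      s'.narr = s.narr) ?_ ?_ ?_).mono fun s' _ h => ⟨h.1.1, h.2⟩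
  · intro k s₁ s₂ h h' hk
    rwa [h, h']
  · simp
  · intro i hi s' h1 h3 h8 h14 ⟨hp, hA⟩
    simp only [Finset.prod_range_succ, evalHook, Cmd.block, runs_seq, runs_op]
    rw [← mul_assoc, ← hp]
    cases b <;> simp [Op.effect, Op.cost, h1, h3, h8, h14, hA]

/-! ### Training and test phases. -/

/-- A sample as an array of natural numbers. -/
def sampleArr (x : Fin n → Fin q) (k : ℕ) : ℕ :=
  if h : k < n then x ⟨k, h⟩ else 0

/-- The table of the numbers of occurrences of the addresses in `M` samples. -/
def tally (addr : (ℕ → ℕ) → ℕ → ℕ) (M : ℕ) (x : ℕ → Fin n → Fin q) (c : ℕ) : ℕ :=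
  ∑ t ∈ Finset.range M, ∑ i ∈ Finset.range n, if addr (sampleArr (x t)) i = c then 1 else 0

/-- A draw leaves the cells from `n` on as they were, whereas `sampleArr` is zero there; addresses
only read cells below `n`. -/
theorem parentAddr_congr {G : Digraph (Fin n)} {d : ℕ} {X Y : ℕ → ℕ} (h : ∀ j < n, X j = Y j)
    (i : ℕ) : parentAddr G q d X i = parentAddr G q d Y i := by
  rw [parentAddr, parentAddr, code_congr fun j hj => h j (parentList_lt hj)]

theorem familyAddr_congr {G : Digraph (Fin n)} {d : ℕ} {X Y : ℕ → ℕ} (h : ∀ j < n, X j = Y j)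
    {i : ℕ} (hi : i < n) : familyAddr G q d X i = familyAddr G q d Y i := by
  rw [familyAddr, familyAddr, h i hi, code_congr fun j hj => h j (parentList_lt hj)]

theorem evalProd_congr {G : Digraph (Fin n)} {d : ℕ} {D N X Y : ℕ → ℕ} (h : ∀ j < n, X j = Y j) :
    evalProd G q d D N X = evalProd G q d D N Y :=
  Finset.prod_congr rfl fun i hi => by
    rw [familyAddr_congr h (Finset.mem_range.1 hi), parentAddr_congr h]

/-- Count the occurrences in samples from one of the two distributions. -/
def trainCmd (b : Bool) : Cmd :=
  .for 12 5 (.op (.draw b 3) ;; nodeLoop b (countHook b))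

theorem runs_trainCmd {d : ℕ} {G : Bool → Digraph (Fin n)} {s : State} (hs : Tables q d G s)
    (b : Bool) (hd : ∀ i < n, (parentList (G b) i).length ≤ d)
    (h8 : ∀ c, s.narr (8 + b.toNat) c = 0) (h10 : ∀ c, s.narr (10 + b.toNat) c = 0)
    (hb : s.draws b = 0) :
    Runs ω (trainCmd b) s fun s' =>
      (s'.narr (8 + b.toNat) = tally (parentAddr (G b) q d) (s.nreg 5) (ω.sample b) ∧
      s'.narr (10 + b.toNat) = tally (familyAddr (G b) q d) (s.nreg 5) (ω.sample b) ∧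
      s'.draws = Function.update s.draws b (s.nreg 5)) ∧
      s'.time ≤ s.time + s.nreg 5 * (n * (7 * d + 22) + 7) + 2 := by
  refine (Runs.for (fun k s' =>
    s'.narr (8 + b.toNat) = tally (parentAddr (G b) q d) k (ω.sample b) ∧
    s'.narr (10 + b.toNat) = tally (familyAddr (G b) q d) k (ω.sample b) ∧
    s'.draws = Function.update s.draws b k) (n * (7 * d + 22) + 5) hs.one_eq
    (by cases b <;> decide) (by decide) (by decide) ?_ ?_ ?_).mono fun s' _ h => ⟨h.1, h.2⟩
  · intro k s' v t h
    exact h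
  · refine ⟨funext fun c => by simp [h8, tally], funext fun c => by simp [h10, tally], ?_⟩
    rw [← hb, Function.update_eq_self]
  · intro k hk s' hkeep _ ⟨hD, hN, hdr⟩
    rw [runs_seq, runs_op]
    have hs' : Tables q d G s' := hs.of_keeps hkeep (by cases b <;> decide)
    set s₁ := ((Op.draw b 3).effect ω s').tick ((Op.draw b 3).cost n) with hs₁
    have hT : Tables q d G s₁ :=
      hs'.of_keeps (Exec.op (ω := ω) (Op.draw b 3) s').keeps (by cases b <;> decide)
    have hbk : s'.draws b = k := by rw [hdr, Function.update_self]
    have e3 : ∀ j < n, s₁.narr 3 j = sampleArr (ω.sample b k) j := fun j hj => by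
      simp [hs₁, Op.effect, sampleArr, hj, hbk]
    refine (runs_count hT b hd fun j hj => ?_).mono fun s₂ he₂ ⟨⟨hD₂, hN₂⟩, ht₂⟩ => ?_
    · rw [e3 j hj]
      simp [sampleArr, hj]
    · have f8 : s₁.narr (8 + b.toNat) = s'.narr (8 + b.toNat) := by
        cases b <;> simp [hs₁, Op.effect]
      have f10 : s₁.narr (10 + b.toNat) = s'.narr (10 + b.toNat) := by
        cases b <;> simp [hs₁, Op.effect]
      refine ⟨⟨funext fun c => ?_, funext fun c => ?_, ?_⟩, ?_⟩
      · rw [hD₂, f8, hD]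
        simp only [tally, Finset.sum_range_succ, parentAddr_congr e3]
      · rw [hN₂, f10, hN]
        simp only [tally, Finset.sum_range_succ]
        congr 1
        refine Finset.sum_congr rfl fun i hi => ?_
        rw [familyAddr_congr e3 (Finset.mem_range.1 hi)]
      · rw [he₂.keeps.draws (by cases b <;> decide)]
        simp [hs₁, Op.effect, hbk, hdr]
      · refine ht₂.trans ?_
        simp only [hs₁, Op.effect, Op.cost, State.tick_time]
        apply le_of_eq
        ring

/-- Average the estimated loss over test samples from the first distribution. -/
def testCmd : Cmd :=
  .block (.const 10 0) [.cast 8 10, .cast 10 10, .cast 9 3] ;;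
  .for 12 5 (.block (.draw false 3) [.cast 5 3, .cast 6 3] ;;
    nodeLoop false (evalHook false) ;; nodeLoop true (evalHook true) ;;
    .block (.rdiv 6 6 5) [.rsub 6 9 6] ;;
    .branch (.rlt 10 6) (.op (.radd 8 8 6)) (.op (.const 10 0))) ;;
  .block (.cast 5 5) [.rdiv 0 8 5]

/-- The sample index starts at the current number of draws, so after training the test samples are
fresh. The constants 0 and 1 are cast into real registers, and the branch realizes max(0, ·), with a
dummy instruction when nothing is added. -/
theorem runs_testCmd {d : ℕ} {G : Bool → Digraph (Fin n)} {s : State} (hs : Tables q d G s)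
    (hd : ∀ b, ∀ i < n, (parentList (G b) i).length ≤ d) :
    Runs ω testCmd s fun s' =>
      s'.rreg 0 = (∑ t ∈ Finset.range (s.nreg 5), max 0 (1 -
        evalProd (G true) q d (s.narr 9) (s.narr 11)
          (sampleArr (ω.sample false (s.draws false + t))) /
        evalProd (G false) q d (s.narr 8) (s.narr 10)
          (sampleArr (ω.sample false (s.draws false + t))))) / s.nreg 5 ∧
      s'.draws = Function.update s.draws false (s.draws false + s.nreg 5) ∧
      s'.time ≤ s.time + s.nreg 5 * (n * (14 * d + 43) + 17) + 8 := by
  simp only [testCmd, runs_seq, Cmd.block, runs_op]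
  set s₀ := ((Op.cast 9 3).effect ω (((Op.cast 10 10).effect ω (((Op.cast 8 10).effect ω
    (((Op.const 10 0).effect ω s).tick ((Op.const 10 0).cost n))).tick
      ((Op.cast 8 10).cost n))).tick ((Op.cast 10 10).cost n))).tick ((Op.cast 9 3).cost n) with hs₀
  have hT₀ : Tables q d G s₀ :=
    hs.of_keeps (Exec.seq (Exec.op (ω := ω) (.const 10 0) _) (Exec.seq (Exec.op (.cast 8 10) _)
      (Exec.seq (Exec.op (.cast 10 10) _) (Exec.op (.cast 9 3) _)))).keeps (by decide)
  have a5 : s₀.nreg 5 = s.nreg 5 := by simp [hs₀, Op.effect]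
  have aA : s₀.narr = s.narr := by simp [hs₀, Op.effect]
  have aD : s₀.draws = s.draws := by simp [hs₀, Op.effect]
  have aT : s₀.time = s.time + 4 := by simp [hs₀, Op.effect, Op.cost]
  have r8 : s₀.rreg 8 = 0 := by simp [hs₀, Op.effect]
  have r9 : s₀.rreg 9 = 1 := by simp [hs₀, Op.effect, hs.one_eq]
  have r10 : s₀.rreg 10 = 0 := by simp [hs₀, Op.effect]
  rw [← a5, ← aA, ← aD]
  refine (Runs.for (fun k s' =>
    s'.rreg 8 = (∑ t ∈ Finset.range k, max 0 (1 -
        evalProd (G true) q d (s₀.narr 9) (s₀.narr 11)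
          (sampleArr (ω.sample false (s₀.draws false + t))) /
        evalProd (G false) q d (s₀.narr 8) (s₀.narr 10)
          (sampleArr (ω.sample false (s₀.draws false + t))))) ∧
    s'.draws = Function.update s₀.draws false (s₀.draws false + k)) (n * (14 * d + 43) + 15)
    hT₀.one_eq (by decide) (by decide) (by decide) ?_ ?_ ?_).mono ?_
  · intro k s' v t h
    exact h
  · simp [r8]
  · intro k hk s' hkeep _ ⟨h8, hdr⟩
    simp only [runs_seq, runs_op]
    have hs' : Tables q d G s' := hT₀.of_keeps hkeep (by decide)
    set s₁ := ((Op.cast 6 3).effect ω (((Op.cast 5 3).effect ω (((Op.draw false 3).effect ω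
      s').tick ((Op.draw false 3).cost n))).tick ((Op.cast 5 3).cost n))).tick
        ((Op.cast 6 3).cost n) with hs₁
    have hT₁ : Tables q d G s₁ :=
      hs'.of_keeps (Exec.seq (Exec.op (ω := ω) (.draw false 3) _) (Exec.seq
        (Exec.op (.cast 5 3) _) (Exec.op (.cast 6 3) _))).keeps (by decide)
    have hbk : s'.draws false = s₀.draws false + k := by rw [hdr, Function.update_self]
    have e3 : ∀ j < n, s₁.narr 3 j = sampleArr (ω.sample false (s₀.draws false + k)) j :=
      fun j hj => by simp [hs₁, Op.effect, sampleArr, hj, hbk]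
    have hlt : ∀ j < n, s₁.narr 3 j < q := fun j hj => by
      rw [e3 j hj]
      simp [sampleArr, hj]
    have eA : ∀ A, A ≠ 3 → s'.narr A = s₀.narr A → s₁.narr A = s₀.narr A := fun A hA h => by
      simp [hs₁, Op.effect, hA, h]
    refine (runs_eval hT₁ false (hd false) hlt).mono fun s₂ he₂ ⟨h5, ht₂⟩ => ?_
    have hT₂ : Tables q d G s₂ := hT₁.of_keeps he₂.keeps (by decide)
    have k3 := he₂.keeps.narr 3 (by decide)
    refine (runs_eval hT₂ true (hd true) (by rwa [k3])).mono fun s₃ he₃ ⟨h6, ht₃⟩ => ?_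
    have e5 : s₃.rreg 5 = evalProd (G false) q d (s₀.narr 8) (s₀.narr 10)
        (sampleArr (ω.sample false (s₀.draws false + k))) := by
      rw [he₃.keeps.rreg 5 (by decide)]
      refine h5.trans ?_
      rw [evalProd_congr e3]
      simp only [Bool.toNat_false, add_zero]
      rw [eA 8 (by decide) (hkeep.narr 8 (by decide)),
        eA 10 (by decide) (hkeep.narr 10 (by decide))]
      simp [hs₁, Op.effect, hs'.one_eq]
    have e6 : s₃.rreg 6 = evalProd (G true) q d (s₀.narr 9) (s₀.narr 11)
        (sampleArr (ω.sample false (s₀.draws false + k))) := by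
      refine h6.trans ?_
      rw [k3, evalProd_congr e3]
      simp only [Bool.toNat_true]
      rw [he₂.keeps.narr 9 (by decide), he₂.keeps.narr 11 (by decide),
        he₂.keeps.rreg 6 (by decide), eA 9 (by decide) (hkeep.narr 9 (by decide)),
        eA 11 (by decide) (hkeep.narr 11 (by decide))]
      simp [hs₁, Op.effect, hs'.one_eq]
    have e9 : s₃.rreg 9 = 1 := by
      rw [he₃.keeps.rreg 9 (by decide), he₂.keeps.rreg 9 (by decide), ← r9,
        ← hkeep.rreg 9 (by decide)]
      simp [hs₁, Op.effect]
    have e10 : s₃.rreg 10 = 0 := by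
      rw [he₃.keeps.rreg 10 (by decide), he₂.keeps.rreg 10 (by decide), ← r10,
        ← hkeep.rreg 10 (by decide)]
      simp [hs₁, Op.effect]
    have e8 : s₃.rreg 8 = s'.rreg 8 := by
      rw [he₃.keeps.rreg 8 (by decide), he₂.keeps.rreg 8 (by decide)]
      simp [hs₁, Op.effect]
    have ed : s₃.draws = Function.update s₀.draws false (s₀.draws false + (k + 1)) := by
      rw [he₃.keeps.draws (by decide), he₂.keeps.draws (by decide)]
      simp [hs₁, Op.effect, hbk, hdr, add_assoc]
    have et : s₃.time ≤ s'.time + (n * (14 * d + 43) + 11) := by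
      refine (ht₃.trans (Nat.add_le_add_right ht₂ _)).trans (le_of_eq ?_)
      simp only [hs₁, Op.effect, Op.cost, State.tick_time, State.setR_time]
      ring
    rw [Finset.sum_range_succ, ← h8, ← e8, runs_branch]
    rw [← e5, ← e6]
    simp only [Test.holds, Op.effect, State.tick_rreg, State.setR_rreg, runs_op, if_true,
      e9, e10, Nat.reduceEqDiff, if_false]
    split_ifs with h
    · refine ⟨⟨?_, by simpa using ed⟩, ?_⟩
      · simp [max_eq_right h.le]
      · simp [Op.cost]
        omega
    · refine ⟨⟨?_, by simpa using ed⟩, ?_⟩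
      · simp [max_eq_left (not_lt.1 h)]
      · simp [Op.cost]
        omega
  · intro s' he ⟨⟨h8, hdr⟩, ht⟩
    have e5 := he.keeps.nreg 5 (by decide)
    refine ⟨?_, ?_, ?_⟩
    · simp [Op.effect, h8, e5]
    · simpa [Op.effect] using hdr
    · simp only [Op.effect, Op.cost, State.tick_time, State.setR_time] at ht ⊢
      rw [aT] at ht
      linarith

/-! ### Preprocessing: power, multiplication table, phase size, parent lists. -/

/-- `y_1 := q ^ (d + 1)` -/
def powerCmd : Cmd :=
  .block (.const 3 1) [.add 11 2 3, .cast 1 3, .cast 2 1] ;; .for 7 11 (.op (.rmul 1 1 2))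

theorem runs_powerCmd {s : State} {d : ℕ} (h1 : s.nreg 1 = q) (h2 : s.nreg 2 = d) :
    Runs ω powerCmd s fun s' => (s'.nreg 3 = 1 ∧ s'.rreg 1 = (q ^ (d + 1) : ℕ)) ∧
      s'.time ≤ s.time + (3 * d + 9) := by
  simp only [powerCmd, Cmd.block, runs_seq, runs_op]
  refine (Runs.for (fun k s' => s'.rreg 1 = (q ^ k : ℕ)) 1 ?_ (by decide) (by decide) (by decide)
    ?_ ?_ ?_).mono ?_
  · simp [Op.effect]
  · intro k s' v t h
    exact h
  · simp [Op.effect]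
  · intro k _ s' hkeep _ h
    have := hkeep.rreg 2 (by decide)
    simp [Op.effect, h1] at this
    simp [runs_op, Op.effect, Op.cost, h, this, pow_succ]
  · intro s' he ⟨h, ht⟩
    have e3 := he.keeps.nreg 3 (by decide)
    simp [Op.effect, Op.cost, h2] at h ht e3
    refine ⟨⟨e3, by simpa using h⟩, by omega⟩

/-- Tabulate the multiples of `q`, and convert `y_1` to a natural number. -/
def tableCmd : Cmd :=
  .block (.const 4 0) [.const 10 0, .cast 3 4] ;;
  .loop (.rlt 3 1) (.block (.store 2 4 10) [.add 10 10 1, .add 4 4 3, .cast 3 4])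

/-- The power was computed as a real, since naturals cannot be multiplied. Counting until the cast
counter reaches it recovers it as a natural, while multiples of q accumulate by addition. -/
theorem runs_tableCmd {s : State} {Q : ℕ} (h1 : s.nreg 1 = q) (h3 : s.nreg 3 = 1)
    (hQ : s.rreg 1 = Q) :
    Runs ω tableCmd s fun s' => (s'.nreg 4 = Q ∧ ∀ k < Q, s'.narr 2 k = q * k) ∧
      s'.time ≤ s.time + (5 * Q + 4) := by
  simp only [tableCmd, Cmd.block, runs_seq, runs_op]
  refine Runs.loop Q (fun k s' => s'.nreg 4 = k ∧ s'.nreg 10 = q * k ∧ s'.rreg 3 = k ∧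
    (∀ j < k, s'.narr 2 j = q * j) ∧ s'.time = s.time + 3 + 5 * k) ?_ ?_ ?_
  · simp [Op.effect, Op.cost]
  · intro k hk s' hkeep ⟨e4, e10, er, eT, et⟩
    have k1 := hkeep.nreg 1 (by decide)
    have k3 := hkeep.nreg 3 (by decide)
    have kr := hkeep.rreg 1 (by decide)
    simp [Op.effect, h1, h3, hQ] at k1 k3 kr
    refine ⟨by simpa [Test.holds, er, kr] using hk, ?_⟩
    simp only [runs_seq, runs_op]
    simp only [Op.effect, Op.cost, State.tick_nreg, State.setN_nreg, State.setR_nreg,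
      State.tick_narr, State.setN_narr, State.setR_narr, State.tick_rreg, State.setR_rreg,
      State.tick_time, State.setN_time, State.setR_time, e4, e10, et, k1, k3, Function.update_self]
    norm_num
    refine ⟨by ring, fun j hj => ?_, by ring⟩
    rw [Function.update_apply]
    split_ifs with h
    · rw [h]
    · exact eT j (by omega)
  · intro s' hkeep ⟨e4, _, er, eT, et⟩
    have kr := hkeep.rreg 1 (by decide)
    simp [Op.effect, hQ] at kr
    refine ⟨by simp [Test.holds, er, kr], ⟨e4, eT⟩, ?_⟩
    simp [et]
    omega

/-- The number of samples in each of the three phases. -/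
noncomputable def phaseSize (n q d : ℕ) (ε : ℝ) : ℕ :=
  ⌈100 * ((q ^ (d + 1) : ℕ) : ℝ) * n / (ε * ε)⌉₊

/-- `x_5 := ` the number of samples in each phase. -/
def sizeCmd : Cmd :=
  .block (.const 10 100) [.cast 5 10, .rmul 5 5 1, .cast 6 0, .rmul 5 5 6, .rmul 7 0 0,
    .rdiv 5 5 7, .const 5 0, .cast 3 5] ;;
  .loop (.rlt 3 5) (.block (.add 5 5 3) [.cast 3 5])

/-- The ceiling is reached by counting: k < ⌈a⌉ exactly when k < a, so the loop stops at ⌈a⌉. -/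
theorem runs_sizeCmd {s : State} {d : ℕ} (h0 : s.nreg 0 = n) (h3 : s.nreg 3 = 1)
    (hQ : s.rreg 1 = (q ^ (d + 1) : ℕ)) :
    Runs ω sizeCmd s fun s' => s'.nreg 5 = phaseSize n q d (s.rreg 0) ∧
      s'.time ≤ s.time + (3 * phaseSize n q d (s.rreg 0) + 10) := by
  simp only [sizeCmd, Cmd.block, runs_seq, runs_op]
  refine Runs.loop (phaseSize n q d (s.rreg 0)) (fun k s' => s'.nreg 5 = k ∧ s'.rreg 3 = k ∧
    s'.time = s.time + 9 + 3 * k) ?_ ?_ ?_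
  · simp [Op.effect, Op.cost]
  · intro k hk s' hkeep ⟨e5, er, et⟩
    have k3 := hkeep.nreg 3 (by decide)
    have kr := hkeep.rreg 5 (by decide)
    simp [Op.effect, h0, h3, hQ] at k3 kr
    rw [phaseSize, Nat.lt_ceil] at hk
    refine ⟨by simpa [Test.holds, er, kr] using hk, ?_⟩
    simp [runs_seq, runs_op, Op.effect, Op.cost, e5, k3, et]
    ring
  · intro s' hkeep ⟨e5, er, et⟩
    have kr := hkeep.rreg 5 (by decide)
    simp [Op.effect, h0, hQ] at kr
    have := Nat.le_ceil (100 * ((q ^ (d + 1) : ℕ) : ℝ) * n / (s.rreg 0 * s.rreg 0))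
    rw [← phaseSize] at this
    refine ⟨by simpa [Test.holds, er, kr] using this, e5, ?_⟩
    simp [et]
    omega

/-- List the parents of every node. -/
def listCmd (b : Bool) : Cmd :=
  .block (.const 13 0) [.const 15 0] ;;
  .for 6 0 (.block (.const 11 0) [.add 16 6 15] ;;
    .for 7 0 (.op (.load 10 b.toNat 16) ;;
      .branch (.lt 15 10)
        (.block (.add 14 13 11) [.store (4 + b.toNat) 14 7, .add 11 11 3])
        (.op (.const 14 0)) ;;
      .op (.add 16 16 0)) ;;
    .block (.store (6 + b.toNat) 6 11) [.add 13 13 0])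

theorem adjCells_pos_iff {G : Digraph (Fin n)} {k : ℕ} : 0 < adjCells G k ↔ adjCells G k = 1 := by
  unfold adjCells
  split_ifs <;> simp

/-- The parents of `i` are read off column `i` of the matrix, stepping by n. The list of `i` starts
at cell i n and has at most n entries; the inner invariant records that cells below i n, which hold
the earlier lists, stay untouched. -/
theorem runs_listCmd {s : State} {G : Digraph (Fin n)} (b : Bool) (h0 : s.nreg 0 = n)
    (h3 : s.nreg 3 = 1) (hG : ∀ k, s.narr b.toNat k = adjCells G k) :
    Runs ω (listCmd b) s fun s' =>
      (∀ i < n, s'.narr (6 + b.toNat) i = (parentList G i).length ∧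
        (List.range (parentList G i).length).map (fun r => s'.narr (4 + b.toNat) (i * n + r)) =
          parentList G i) ∧ s'.time ≤ s.time + (n * (8 * n + 8) + 4) := by
  simp only [listCmd, Cmd.block, runs_seq, runs_op]
  refine (Runs.for (fun k s' => s'.nreg 13 = k * n ∧ ∀ i < k,
    s'.narr (6 + b.toNat) i = (parentList G i).length ∧
      (List.range (parentList G i).length).map (fun r => s'.narr (4 + b.toNat) (i * n + r)) =
        parentList G i) (8 * n + 6) ?_ (by cases b <;> decide) (by decide) (by decide)
    ?_ ?_ ?_).mono ?_
  · simp [Op.effect, h3]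
  · intro k s' v t h
    simpa using h
  · simp [Op.effect]
  · intro i hi s' hkeep h6 ⟨h13, hprev⟩
    have hi : i < n := by simpa [Op.effect, h0] using hi
    have k0 := hkeep.nreg 0 (by cases b <;> decide)
    have k3 := hkeep.nreg 3 (by cases b <;> decide)
    have k15 := hkeep.nreg 15 (by cases b <;> decide)
    have kG := hkeep.narr b.toNat (by cases b <;> decide)
    simp [Op.effect, h0, h3] at k0 k3 k15 kG
    simp only [runs_seq, runs_op]
    refine (Runs.for (fun k s₁ => s₁.nreg 16 = k * n + i ∧
      s₁.nreg 11 = ((List.range k).filter fun j => adjCells G (j * n + i) = 1).length ∧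
      (List.range ((List.range k).filter fun j => adjCells G (j * n + i) = 1).length).map
        (fun r => s₁.narr (4 + b.toNat) (i * n + r)) =
          ((List.range k).filter fun j => adjCells G (j * n + i) = 1) ∧
      ∀ a < i * n, s₁.narr (4 + b.toNat) a = s'.narr (4 + b.toNat) a) 6 ?_
      (by cases b <;> decide) (by decide) (by decide) ?_ ?_ ?_).mono ?_
    · simp [Op.effect, k3]
    · intro k s₁ v t h
      simpa using h
    · simp [Op.effect, h6, k15]
    · intro k hk s₁ hkeep₁ h7 ⟨h16, h11, hmap, hlow⟩
      have l0 := hkeep₁.nreg 0 (by cases b <;> decide)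
      have l3 := hkeep₁.nreg 3 (by cases b <;> decide)
      have l15 := hkeep₁.nreg 15 (by cases b <;> decide)
      have l13 := hkeep₁.nreg 13 (by cases b <;> decide)
      have lG := hkeep₁.narr b.toNat (by cases b <;> decide)
      simp [Op.effect, k0, k3, k15, h13] at l0 l3 l15 l13 lG
      rw [kG] at lG
      simp only [runs_seq, runs_op, runs_branch, Test.holds]
      simp only [Op.effect, State.tick_nreg, State.setN_nreg, Nat.reduceEqDiff, if_true, if_false,
        l15, lG, h16, hG, adjCells_pos_iff]
      rw [List.range_succ, List.filter_append]
      split_ifs with hadj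
      · have hf : [k].filter (fun j => decide (adjCells G (j * n + i) = 1)) = [k] := by
          simp [hadj]
        rw [hf]
        set L := (List.range k).filter fun j => decide (adjCells G (j * n + i) = 1) with hL
        simp only [Op.cost, State.tick_narr, State.setN_narr, State.tick_time, State.setN_time, l13,
          h11, h7, l3, l0, Function.update_self, List.length_append, List.length_singleton]
        refine ⟨⟨by ring, trivial, ?_, fun a ha => ?_⟩, by omega⟩
        · rw [List.range_succ, List.map_append, List.map_singleton, Function.update_self]
          congr 1
          conv_rhs => rw [← hmap]
          refine List.map_congr_left fun r hr => ?_
          rw [Function.update_of_ne]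
          have := List.mem_range.1 hr
          omega
        · rw [Function.update_of_ne (by omega)]
          exact hlow a ha
      · have hf : [k].filter (fun j => decide (adjCells G (j * n + i) = 1)) = [] := by
          simp [hadj]
        rw [hf, List.append_nil]
        simp only [Op.cost, State.tick_narr, State.setN_narr, State.tick_time, State.setN_time, h11,
          l0]
        exact ⟨⟨by ring, trivial, hmap, hlow⟩, by omega⟩
    · intro s₁ he₁ ⟨⟨h16, h11, hmap, hlow⟩, ht₁⟩
      have l0 := he₁.keeps.nreg 0 (by cases b <;> decide)
      have l6 := he₁.keeps.nreg 6 (by cases b <;> decide)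
      have l13 := he₁.keeps.nreg 13 (by cases b <;> decide)
      have lC := he₁.keeps.narr (6 + b.toNat) (by cases b <;> decide)
      simp [Op.effect, k0, h6, h13] at l0 l6 l13 lC
      simp [Op.effect, Op.cost, k0] at h11 hmap ht₁
      have hne : ¬ (4 + b.toNat = 6 + b.toNat) := by omega
      refine ⟨⟨by simp [Op.effect, l13, l0, add_mul], fun j hj => ?_⟩, ?_⟩
      · simp only [Op.effect, State.tick_narr, State.setN_narr, Function.update_self,
          Function.update_of_ne hne, State.tick_nreg, l6, lC, h11]
        rcases (Nat.lt_succ_iff.1 hj).eq_or_lt with rfl | hj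
        · exact ⟨Function.update_self _ _ _, hmap⟩
        · refine ⟨?_, ?_⟩
          · rw [Function.update_of_ne hj.ne]
            exact (hprev j hj).1
          · refine Eq.trans (List.map_congr_left fun r hr => ?_) (hprev j hj).2
            have h1 := List.mem_range.1 hr
            have h2 : (parentList G j).length ≤ n :=
              (List.length_filter_le _ _).trans_eq List.length_range
            refine hlow _ ?_
            calc j * n + r < j * n + n := by omega
              _ = (j + 1) * n := by ring
              _ ≤ i * n := Nat.mul_le_mul_right n hj
      · simp [Op.effect, Op.cost]
        linarith
  · intro s' he ⟨⟨_, h⟩, ht⟩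
    simp [Op.effect, Op.cost, h0] at h ht
    exact ⟨h, by linarith⟩

/-! ### The tables of the program and the estimated network -/

theorem adjCells_eq_one_iff {G : Digraph (Fin n)} (i j : Fin n) :
    adjCells G (j * n + i) = 1 ↔ G.Adj j i := by
  have h : adjCells G (j * n + i) = 1 ↔
      ∃ i' j' : Fin n, (j : ℕ) * n + i = i' * n + j' ∧ G.Adj i' j' := by
    unfold adjCells
    split_ifs with h <;> simpa using h
  rw [h]
  constructor
  · rintro ⟨j', i', he, hadj⟩
    have hi : (i : ℕ) = i' := by
      have := congrArg (· % n) he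
      simpa [Nat.mul_add_mod', Nat.mod_eq_of_lt i.2, Nat.mod_eq_of_lt i'.2] using this
    have hj : (j : ℕ) = j' := by
      rw [hi] at he
      exact Nat.eq_of_mul_eq_mul_right i.pos (Nat.add_right_cancel he)
    rwa [Fin.ext hi, Fin.ext hj]
  · exact fun hadj => ⟨j, i, rfl, hadj⟩

theorem mem_parentList {G : Digraph (Fin n)} (i j : Fin n) :
    (j : ℕ) ∈ parentList G i ↔ j ∈ parents G i := by
  simp [parentList, parents, adjCells_eq_one_iff]

theorem length_parentList_le {G : Digraph (Fin n)} {d : ℕ} (hd : InDegreeLE G d) (i : ℕ)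
    (hi : i < n) : (parentList G i).length ≤ d := by
  have hnd : (parentList G i).Nodup := List.nodup_range.filter _
  have h : ((parentList G i).toFinset : Set ℕ) ⊆
      (fun j : Fin n => (j : ℕ)) '' parents G ⟨i, hi⟩ := fun j hj => by
    have hj : j ∈ parentList G i := by simpa using hj
    exact ⟨⟨j, parentList_lt hj⟩, (mem_parentList ⟨i, hi⟩ ⟨j, parentList_lt hj⟩).1 hj, rfl⟩
  have h1 := (Set.encard_le_encard h).trans
    ((Set.encard_image_le _ _).trans (hd ⟨i, hi⟩))
  rw [Set.encard_coe_eq_coe_finsetCard, List.toFinset_card_of_nodup hnd] at h1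
  exact_mod_cast h1

theorem sampleArr_lt (x : Fin n → Fin q) (j : ℕ) (hj : j < n) : sampleArr x j < q := by
  simp [sampleArr, hj]

theorem code_sampleArr_eq_iff {G : Digraph (Fin n)} (i : Fin n) (x y : Fin n → Fin q) :
    code q (sampleArr y) (parentList G i) = code q (sampleArr x) (parentList G i) ↔
      y ∈ agree (parents G i) x := by
  have h : y ∈ agree (parents G i) x ↔ ∀ j ∈ parentList G i, sampleArr y j = sampleArr x j := by
    constructor
    · intro hy j hj
      have hjn := parentList_lt hj
      simp [sampleArr, hjn, hy _ ((mem_parentList i ⟨j, hjn⟩).1 hj)]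
    · intro hy j hj
      have := hy j ((mem_parentList i j).2 hj)
      simpa [sampleArr, Fin.ext_iff] using this
  rw [h]
  exact ⟨code_inj (fun j hj => sampleArr_lt y j (parentList_lt hj))
    fun j hj => sampleArr_lt x j (parentList_lt hj), code_congr⟩

theorem mul_add_eq_mul_add_iff {Q a b c c' : ℕ} (hc : c < Q) (hc' : c' < Q) :
    a * Q + c = b * Q + c' ↔ a = b ∧ c = c' := by
  constructor
  · intro h
    have h1 : c = c' := by
      have := congrArg (· % Q) h
      simpa [Nat.mul_add_mod', Nat.mod_eq_of_lt hc, Nat.mod_eq_of_lt hc'] using this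
    subst h1
    exact ⟨Nat.eq_of_mul_eq_mul_right (by omega) (Nat.add_right_cancel h), rfl⟩
  · rintro ⟨rfl, rfl⟩
    rfl

section

variable {G : Digraph (Fin n)} {d : ℕ}

theorem code_parentList_lt (hd : InDegreeLE G d) (hq : 1 ≤ q) {i : ℕ} (hi : i < n)
    (x : Fin n → Fin q) : code q (sampleArr x) (parentList G i) < q ^ d :=
  (code_lt fun j hj => sampleArr_lt x j (parentList_lt hj)).trans_le
    (Nat.pow_le_pow_right hq (length_parentList_le hd i hi))

/-- Codes are smaller than the block length q^(d+1), so blocks of different nodes do not overlap,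
and within a block the code determines the parent values. -/
theorem parentAddr_eq_iff (hd : InDegreeLE G d) (hq : 1 ≤ q) (i' i : Fin n)
    (x y : Fin n → Fin q) :
    parentAddr G q d (sampleArr y) i' = parentAddr G q d (sampleArr x) i ↔
      i' = i ∧ y ∈ agree (parents G i) x := by
  have h := Nat.pow_le_pow_right hq (Nat.le_succ d)
  rw [parentAddr, parentAddr, mul_add_eq_mul_add_iff ((code_parentList_lt hd hq i'.2 y).trans_le h)
    ((code_parentList_lt hd hq i.2 x).trans_le h), ← Fin.ext_iff]
  refine and_congr_right fun hi => ?_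
  rw [hi, code_sampleArr_eq_iff]

theorem familyAddr_eq_iff (hd : InDegreeLE G d) (hq : 1 ≤ q) (i' i : Fin n)
    (x y : Fin n → Fin q) :
    familyAddr G q d (sampleArr y) i' = familyAddr G q d (sampleArr x) i ↔
      i' = i ∧ y ∈ agree (insert i (parents G i)) x := by
  have h : ∀ (i : Fin n) (x : Fin n → Fin q),
      q * code q (sampleArr x) (parentList G i) + sampleArr x i < q ^ (d + 1) := fun i x => by
    have h1 := code_parentList_lt hd hq i.2 x
    have h2 := sampleArr_lt x i i.2
    rw [pow_succ]
    nlinarith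
  rw [familyAddr, familyAddr, mul_add_eq_mul_add_iff (h i' y) (h i x), ← Fin.ext_iff]
  refine and_congr_right fun hi => ?_
  subst hi
  rw [mul_comm q, mul_comm q, mul_add_eq_mul_add_iff (sampleArr_lt y _ i'.2)
    (sampleArr_lt x _ i'.2), code_sampleArr_eq_iff, Set.insert_eq, ← agree_inter, and_comm]
  refine and_congr_left fun _ => ?_
  simp [agree, sampleArr, ← Fin.ext_iff]

/-- Only node `i` can reach this address, hence each sample is counted at most once and the double
sum is the number of samples in `E`. -/
theorem tally_eq_hits {addr : (ℕ → ℕ) → ℕ → ℕ} {E : Set (Fin n → Fin q)} {i : Fin n}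
    {x : Fin n → Fin q}
    (h : ∀ (i' : Fin n) y, addr (sampleArr y) i' = addr (sampleArr x) i ↔ i' = i ∧ y ∈ E)
    (M : ℕ) (s : ℕ → Fin n → Fin q) :
    (tally addr M s (addr (sampleArr x) i) : ℝ) = hits E fun t : Fin M => s t := by
  classical
  rw [tally, hits, Finset.sum_range, Nat.cast_sum]
  refine Finset.sum_congr rfl fun t _ => ?_
  rw [Finset.sum_range]
  simp only [h]
  by_cases hE : s t ∈ E <;> simp [hE]

theorem evalProd_eq_netEstimate (hd : InDegreeLE G d) (hq : 1 ≤ q) (M : ℕ)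
    (s : ℕ → Fin n → Fin q) (x : Fin n → Fin q) :
    evalProd G q d (tally (parentAddr G q d) M s) (tally (familyAddr G q d) M s) (sampleArr x) =
      netEstimate G (fun t : Fin M => s t) x := by
  rw [evalProd, netEstimate, Finset.prod_range]
  refine Finset.prod_congr rfl fun i _ => ?_
  rw [laplace, Nat.cast_add, Nat.cast_add,
    tally_eq_hits (fun i' y => familyAddr_eq_iff hd hq i' i x y),
    tally_eq_hits (fun i' y => parentAddr_eq_iff hd hq i' i x y), Nat.cast_one]

end

/-! ### The whole program -/

/-- The distance approximation program. -/
def mainCmd : Cmd :=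
  .op (.const 3 1) ;;
  .branch (.lt 3 1)
    (powerCmd ;; tableCmd ;; sizeCmd ;; listCmd false ;; listCmd true ;; trainCmd false ;;
      trainCmd true ;; testCmd)
    (.block (.draw false 3) [.const 10 0, .cast 0 10])

/-- The total number of samples. -/
noncomputable def sampleSize (n q d : ℕ) (ε : ℝ) : ℕ :=
  if q ≤ 1 then 1 else 3 * phaseSize n q d ε

theorem tvEstimate_mem_Icc (G₁ G₂ : Digraph (Fin n)) {m : ℕ} (T U Z : Fin m → Fin n → Fin q) :
    0 ≤ tvEstimate G₁ G₂ T U Z ∧ tvEstimate G₁ G₂ T U Z ≤ 1 := by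
  refine ⟨div_nonneg (Finset.sum_nonneg fun t _ => le_max_left _ _) (Nat.cast_nonneg m),
    div_le_one_of_le₀ ?_ (Nat.cast_nonneg m)⟩
  refine (Finset.sum_le_sum fun t _ => (max_le zero_le_one ?_ : _ ≤ (1 : ℝ))).trans (by simp)
  have := div_nonneg (netEstimate_pos G₂ U (Z t)).le (netEstimate_pos G₁ T (Z t)).le
  linarith

theorem runs_mainCmd_of_one_lt {d : ℕ} {G₁ G₂ : Digraph (Fin n)} (hd₁ : InDegreeLE G₁ d)
    (hd₂ : InDegreeLE G₂ d) (hq : 1 < q) (ε : ℝ) (ω : Tape n q) :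
    Runs ω mainCmd (input q d G₁ G₂ ε) fun s =>
      s.output = tvEstimate G₁ G₂ (fun t : Fin (phaseSize n q d ε) => ω.1 t)
        (fun t : Fin (phaseSize n q d ε) => ω.2.1 t)
        (fun t : Fin (phaseSize n q d ε) => ω.1 (phaseSize n q d ε + t)) ∧
      s.draws false + s.draws true = 3 * phaseSize n q d ε ∧
      s.time ≤ 5 * q ^ (d + 1) + 3 * d + 16 * (n * n) + 16 * n + 50 +
        phaseSize n q d ε * (n * (28 * d + 87) + 40) := by
  have hd : ∀ b, InDegreeLE (cond b G₂ G₁) d := fun b => by cases b <;> assumption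
  set G : Bool → Digraph (Fin n) := fun b => cond b G₂ G₁ with hG
  set M := phaseSize n q d ε with hM
  rw [mainCmd, runs_seq, runs_op, runs_branch, if_pos (by simpa [Test.holds, Op.effect, input])]
  set s₀ := (((Op.const 3 1).effect ω (input q d G₁ G₂ ε)).tick ((Op.const 3 1).cost n)).tick 1
    with hs₀
  have t₀ : s₀.time = 2 := by simp [hs₀, Op.effect, Op.cost, input]
  have z0 : s₀.nreg 0 = n := by simp [hs₀, Op.effect, input]
  have z1 : s₀.nreg 1 = q := by simp [hs₀, Op.effect, input]
  have z2 : s₀.nreg 2 = d := by simp [hs₀, Op.effect, input]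
  have y0 : s₀.rreg 0 = ε := by simp [hs₀, Op.effect, input]
  have g0 : ∀ k, s₀.narr 0 k = adjCells G₁ k := by simp [hs₀, Op.effect, input]
  have g1 : ∀ k, s₀.narr 1 k = adjCells G₂ k := by simp [hs₀, Op.effect, input]
  have ge : ∀ A, 2 ≤ A → ∀ k, s₀.narr A k = 0 := fun A hA k => by
    have h0 : A ≠ 0 := by omega
    have h1 : A ≠ 1 := by omega
    simp [hs₀, Op.effect, input, h0, h1]
  have gd : s₀.draws = fun _ => 0 := by simp [hs₀, Op.effect, input]
  clear_value s₀
  rw [runs_seq]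
  refine (runs_powerCmd z1 z2).mono fun s₁ he₁ ⟨⟨p3, pr⟩, t₁⟩ => ?_
  rw [runs_seq]
  refine (runs_tableCmd ((he₁.keeps.nreg 1 (by decide)).trans z1) p3 pr).mono
    fun s₂ he₂ ⟨⟨p4, pT⟩, t₂⟩ => ?_
  rw [runs_seq]
  have hk₂ := (Exec.seq he₁ he₂).keeps
  refine (runs_sizeCmd (d := d) (q := q) ((hk₂.nreg 0 (by decide)).trans z0)
    ((he₂.keeps.nreg 3 (by decide)).trans p3) ((he₂.keeps.rreg 1 (by decide)).trans pr)).mono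
    fun s₃ he₃ ⟨p5, t₃⟩ => ?_
  rw [hk₂.rreg 0 (by decide), y0, ← hM] at p5 t₃
  rw [runs_seq]
  have hk₃ := (Exec.seq he₁ (Exec.seq he₂ he₃)).keeps
  have q3 : s₃.nreg 3 = 1 := ((Exec.seq he₂ he₃).keeps.nreg 3 (by decide)).trans p3
  refine (runs_listCmd (G := G₁) false ((hk₃.nreg 0 (by decide)).trans z0) q3 (fun k => by
    rw [hk₃.narr _ (by decide)]; exact g0 k)).mono fun s₄ he₄ ⟨hL₁, t₄⟩ => ?_
  rw [runs_seq]
  have hk₄ := (Exec.seq he₁ (Exec.seq he₂ (Exec.seq he₃ he₄))).keeps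
  refine (runs_listCmd (G := G₂) true ((hk₄.nreg 0 (by decide)).trans z0)
    ((he₄.keeps.nreg 3 (by decide)).trans q3) (fun k => by
    rw [hk₄.narr _ (by decide)]; exact g1 k)).mono fun s₅ he₅ ⟨hL₂, t₅⟩ => ?_
  rw [runs_seq]
  have hk₅ := (Exec.seq he₁ (Exec.seq he₂ (Exec.seq he₃ (Exec.seq he₄ he₅)))).keeps
  have hk₃₅ := (Exec.seq he₃ (Exec.seq he₄ he₅)).keeps
  have hk₄₅ := (Exec.seq he₄ he₅).keeps
  have hT₅ : Tables q d G s₅ := by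
    refine ⟨(hk₅.nreg 0 (by decide)).trans z0, (hk₅.nreg 1 (by decide)).trans z1,
      (hk₄₅.nreg 3 (by decide)).trans q3, (hk₃₅.nreg 4 (by decide)).trans p4, ?_, ?_, ?_⟩
    · rw [hk₃₅.narr 2 (by decide)]
      exact pT
    · intro b i hi
      cases b
      · rw [he₅.keeps.narr (6 + false.toNat) (by decide)]
        exact (hL₁ i hi).1
      · exact (hL₂ i hi).1
    · intro b i hi
      cases b
      · rw [he₅.keeps.narr (4 + false.toNat) (by decide)]
        exact (hL₁ i hi).2
      · exact (hL₂ i hi).2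
  have hdl : ∀ b, ∀ i < n, (parentList (G b) i).length ≤ d := fun b =>
    length_parentList_le (hd b)
  have e5 : s₅.nreg 5 = M := (hk₄₅.nreg 5 (by decide)).trans p5
  have d5 : s₅.draws = fun _ => 0 := (hk₅.draws (by decide)).trans gd
  refine (runs_trainCmd hT₅ false (hdl false)
    (fun c => by rw [hk₅.narr _ (by decide)]; exact ge 8 (by omega) c)
    (fun c => by rw [hk₅.narr _ (by decide)]; exact ge 10 (by omega) c)
    (by rw [d5])).mono fun s₆ he₆ ⟨⟨D₁, N₁, d₆⟩, t₆⟩ => ?_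
  rw [runs_seq]
  have hT₆ : Tables q d G s₆ := hT₅.of_keeps he₆.keeps (by decide)
  have e6 : s₆.nreg 5 = M := (he₆.keeps.nreg 5 (by decide)).trans e5
  refine (runs_trainCmd hT₆ true (hdl true)
    (fun c => by
      rw [he₆.keeps.narr _ (by decide), hk₅.narr _ (by decide)]; exact ge 9 (by omega) c)
    (fun c => by
      rw [he₆.keeps.narr _ (by decide), hk₅.narr _ (by decide)]; exact ge 11 (by omega) c)
    (by rw [d₆, d5]; rfl)).mono fun s₇ he₇ ⟨⟨D₂, N₂, d₇⟩, t₇⟩ => ?_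
  have hT₇ : Tables q d G s₇ := hT₆.of_keeps he₇.keeps (by decide)
  have e7 : s₇.nreg 5 = M := (he₇.keeps.nreg 5 (by decide)).trans e6
  refine (runs_testCmd hT₇ hdl).mono fun s₈ he₈ ⟨o₈, d₈, t₈⟩ => ?_
  have f8 : s₇.narr 8 = tally (parentAddr G₁ q d) M (ω.sample false) := by
    rw [he₇.keeps.narr 8 (by decide), ← e5]; exact D₁
  have f10 : s₇.narr 10 = tally (familyAddr G₁ q d) M (ω.sample false) := by
    rw [he₇.keeps.narr 10 (by decide), ← e5]; exact N₁
  have f9 : s₇.narr 9 = tally (parentAddr G₂ q d) M (ω.sample true) := by rw [← e6]; exact D₂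
  have f11 : s₇.narr 11 = tally (familyAddr G₂ q d) M (ω.sample true) := by rw [← e6]; exact N₂
  have d7f : s₇.draws false = M := by rw [d₇, d₆, d5, e5]; simp
  have d7t : s₇.draws true = M := by rw [d₇, e6]; simp
  refine ⟨?_, ?_, ?_⟩
  · rw [State.output, o₈, f8, f9, f10, f11, d7f, e7, tvEstimate, Finset.sum_range]
    congr 1
    refine Finset.sum_congr rfl fun t _ => ?_
    rw [show G true = G₂ from rfl, show G false = G₁ from rfl,
      evalProd_eq_netEstimate hd₁ hq.le, evalProd_eq_netEstimate hd₂ hq.le]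
    rfl
  · rw [d₈, Function.update_self, Function.update_of_ne (by decide), d7f, d7t, e7]
    ring
  · rw [e5] at t₆
    rw [e6] at t₇
    rw [e7] at t₈
    linarith

/-! ### Bounds for the phase size, the one-letter alphabet, and the theorem. -/

theorem phaseSize_pos {d : ℕ} {ε : ℝ} (hn : 1 ≤ n) (hq : 1 ≤ q) (hε : 0 < ε) :
    0 < phaseSize n q d ε :=
  Nat.ceil_pos.2 (by positivity)

theorem le_phaseSize {d : ℕ} {ε : ℝ} (hε : 0 < ε) :
    100 * ((q : ℝ) ^ (d + 1) * n) ≤ phaseSize n q d ε * ε ^ 2 := by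
  have h := Nat.le_ceil (100 * ((q ^ (d + 1) : ℕ) : ℝ) * n / (ε * ε))
  rw [div_le_iff₀ (by positivity)] at h
  push_cast at h
  rw [phaseSize]
  push_cast
  nlinarith

theorem phaseSize_le {d : ℕ} {ε : ℝ} (hn : 1 ≤ n) (hq : 1 ≤ q) (hε : 0 < ε) (hε1 : ε < 1) :
    (phaseSize n q d ε : ℝ) ≤ 101 * ((q : ℝ) ^ (d + 1) * n * (ε ^ 2)⁻¹) := by
  have h := (Nat.ceil_lt_add_one (a := 100 * ((q ^ (d + 1) : ℕ) : ℝ) * n / (ε * ε))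
    (by positivity)).le
  have h1 : (1 : ℝ) ≤ (q : ℝ) ^ (d + 1) * n := by
    exact_mod_cast Nat.mul_pos (Nat.pow_pos hq) hn
  have h2 : (1 : ℝ) ≤ (ε ^ 2)⁻¹ := (one_le_inv₀ (by positivity)).2 (by nlinarith)
  have h3 : 100 * ((q ^ (d + 1) : ℕ) : ℝ) * n / (ε * ε) =
      100 * ((q : ℝ) ^ (d + 1) * n * (ε ^ 2)⁻¹) := by
    push_cast
    field_simp
  rw [phaseSize]
  rw [h3] at h ⊢
  nlinarith

/-- This allows the preprocessing steps, of order q^(d+1) and n², to be charged to the samples. -/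
theorem mul_le_phaseSize {d : ℕ} {ε : ℝ} (hε : 0 < ε) (hε1 : ε < 1) :
    q ^ (d + 1) * n ≤ phaseSize n q d ε := by
  have h := le_phaseSize (n := n) (q := q) (d := d) hε
  have h2 : (phaseSize n q d ε : ℝ) * ε ^ 2 ≤ phaseSize n q d ε :=
    mul_le_of_le_one_right (Nat.cast_nonneg _) (by nlinarith)
  have h3 : (0 : ℝ) ≤ (q : ℝ) ^ (d + 1) * n := by positivity
  have h4 : (q : ℝ) ^ (d + 1) * n ≤ phaseSize n q d ε := by linarith
  exact_mod_cast h4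

/-- For q = 1 the target C m n does not grow with d, so no loop over d is affordable. There is only
one distribution then, and the answer 0 is exact. The single draw makes m n positive. -/
theorem runs_mainCmd_of_le_one {d : ℕ} {G₁ G₂ : Digraph (Fin n)} (hq : q ≤ 1) (ε : ℝ)
    (ω : Tape n q) :
    Runs ω mainCmd (input q d G₁ G₂ ε) fun s => s.output = 0 ∧
      s.draws false + s.draws true = 1 ∧ s.time = n + 5 := by
  rw [mainCmd, runs_seq, runs_op, runs_branch, if_neg (by simpa [Test.holds, Op.effect, input])]
  simp [Cmd.block, runs_seq, runs_op, Op.effect, Op.cost, input, State.output]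
  ring

theorem tvDist_eq_zero_of_subsingleton {α : Type*} [Fintype α] [Subsingleton α] (P Q : PMF α) :
    tvDist P Q = 0 := by
  have h : ∀ (P : PMF α) (a : α), P a = 1 := fun P a => by
    have := P.tsum_coe
    rwa [tsum_eq_single a fun b hb => absurd (Subsingleton.elim b a) hb] at this
  simp [tvDist, h]

instance isProbabilityMeasure_tapeLaw (P Q : PMF (Fin n → Fin q)) :
    IsProbabilityMeasure (tapeLaw P Q) := by
  unfold tapeLaw
  infer_instance

end RealRAM

/-- There are one program `c`, constants `C`, `k` and a sample size
`m(n, q, d, ε) ≤ C q^(d+1) n ε⁻² (1 + log (q^(d+1) n))^k`, such that for all DAGs `G₁`, `G₂` on `n`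
vertices with in-degree at most `d` the program, given `n`, `q`, `d`, `G₁`, `G₂` and `ε`, is a
distance approximation algorithm for the Bayesian networks over an alphabet of `q` symbols on `G₁`
and on `G₂`, and always draws `m` samples in all and makes at most `C q^(d+1) m n` steps. -/
theorem theorem2p2 :
    ∃ (c : RealRAM.Cmd) (C k : ℕ) (m : ℕ → ℕ → ℕ → ℝ → ℕ),
      ∀ (n q d : ℕ), 1 ≤ n → 1 ≤ q →
        (∀ ε : ℝ, 0 < ε → ε < 1 →
          (m n q d ε : ℝ) ≤ C * ((q : ℝ) ^ (d + 1) * n * (ε ^ 2)⁻¹) *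
            (1 + Real.log ((q : ℝ) ^ (d + 1) * n)) ^ k) ∧
        ∀ G₁ G₂ : Digraph (Fin n), IsDAG G₁ → IsDAG G₂ → InDegreeLE G₁ d → InDegreeLE G₂ d →
          RealRAM.IsDistanceApproximation c (RealRAM.input q d G₁ G₂)
            (bayesNets q G₁) (bayesNets q G₂) ∧
          ∀ (ε : ℝ), 0 < ε → ε < 1 → ∀ (ω : RealRAM.Tape n q) (s : RealRAM.State),
            RealRAM.Exec ω c (RealRAM.input q d G₁ G₂ ε) s →
              s.draws false + s.draws true = m n q d ε ∧
              s.time ≤ C * q ^ (d + 1) * m n q d ε * n := by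
  -- 303 = 3 · 101: three phases, with 101 in place of 100 to pay for the ceiling. The exponent of
  -- the logarithm is 0.
  refine ⟨RealRAM.mainCmd, 303, 0, RealRAM.sampleSize, fun n q d hn hq =>
    ⟨fun ε hε hε1 => ?_, fun G₁ G₂ h₁ h₂ hd₁ hd₂ => ?_⟩⟩
  · rw [pow_zero, mul_one, RealRAM.sampleSize]
    have h := RealRAM.phaseSize_le (d := d) hn hq hε hε1
    split_ifs with h1
    · have h1 : (1 : ℝ) ≤ (q : ℝ) ^ (d + 1) * n := by
        exact_mod_cast Nat.mul_pos (Nat.pow_pos hq) hn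
      have h2 : (1 : ℝ) ≤ (ε ^ 2)⁻¹ := (one_le_inv₀ (by positivity)).2 (by nlinarith)
      push_cast
      nlinarith
    · push_cast
      linarith
  rcases hq.eq_or_lt with rfl | hq1
  · refine ⟨fun ε hε hε1 => ⟨fun ω => ?_, fun P _ Q _ => ?_⟩, fun ε hε hε1 ω s he => ?_⟩
    · obtain ⟨s, he, ho, -⟩ := RealRAM.runs_mainCmd_of_le_one (G₁ := G₁) (G₂ := G₂) (d := d)
        le_rfl ε ω
      exact ⟨s, he, ho.ge, ho.trans_le zero_le_one⟩
    · refine le_trans (b := 1) ?_ ((measure_univ (μ := RealRAM.tapeLaw P Q)).ge.trans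
        (measure_mono fun ω _ => ?_))
      · exact ENNReal.div_le_of_le_mul (by norm_num)
      · obtain ⟨s, he, ho, -⟩ := RealRAM.runs_mainCmd_of_le_one (G₁ := G₁) (G₂ := G₂) (d := d)
          le_rfl ε ω
        refine ⟨s, he, ?_⟩
        rw [ho, RealRAM.tvDist_eq_zero_of_subsingleton]
        constructor <;> linarith
    · obtain ⟨s', he', -, hdr, ht⟩ := RealRAM.runs_mainCmd_of_le_one (G₁ := G₁) (G₂ := G₂)
        (d := d) le_rfl ε ω
      obtain rfl := he.unique he'
      refine ⟨by simpa [RealRAM.sampleSize] using hdr, ?_⟩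
      rw [ht]
      simp [RealRAM.sampleSize]
      omega
  · have hM : ∀ {ε : ℝ}, 0 < ε → 0 < RealRAM.phaseSize n q d ε := RealRAM.phaseSize_pos hn hq
    refine ⟨fun ε hε hε1 => ⟨fun ω => ?_, fun P hP Q hQ => ?_⟩, fun ε hε hε1 ω s he => ?_⟩
    · obtain ⟨s, he, ho, -⟩ := RealRAM.runs_mainCmd_of_one_lt hd₁ hd₂ hq1 ε ω
      refine ⟨s, he, ?_⟩
      rw [ho]
      exact RealRAM.tvEstimate_mem_Icc _ _ _ _ _
    · refine (RealRAM.two_thirds_le_tapeLaw P Q (m := RealRAM.phaseSize n q d ε)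
        (fun T U Z => (tvEstimate G₁ G₂ T U Z - tvDist P Q) ^ 2) (fun _ _ _ => sq_nonneg _)
        (pow_pos hε 2) ?_).trans (measure_mono fun ω hω => ?_)
      · refine (iidE_sq_tvEstimate_sub_le h₁ h₂ hP hQ hn hq hd₁ hd₂ (hM hε)).trans ?_
        -- Markov's inequality requires 33 q^(d+1) n / M ≤ ε² / 3, that is 99 q^(d+1) n ≤ M ε²; this
        -- fixes the 100 in `phaseSize`.
        have := RealRAM.le_phaseSize (n := n) (q := q) (d := d) hε
        rw [div_le_div_iff₀ (by exact_mod_cast hM hε) (by norm_num)]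
        have : (0 : ℝ) ≤ (q : ℝ) ^ (d + 1) * n := by positivity
        linarith
      · obtain ⟨s, he, ho, -⟩ := RealRAM.runs_mainCmd_of_one_lt hd₁ hd₂ hq1 ε ω
        refine ⟨s, he, ?_⟩
        have := abs_le.1 (abs_le_of_sq_le_sq hω hε.le)
        rw [← ho] at this
        constructor <;> linarith [this.1, this.2]
    · obtain ⟨s', he', -, hdr, ht⟩ := RealRAM.runs_mainCmd_of_one_lt hd₁ hd₂ hq1 ε ω
      obtain rfl := he.unique he'
      rw [RealRAM.sampleSize, if_neg (by omega)]
      refine ⟨hdr, ht.trans ?_⟩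
      have hQM := RealRAM.mul_le_phaseSize (n := n) (q := q) (d := d) hε hε1
      have hMp := hM hε
      -- The cost of d per node and sample is absorbed by q^(d+1); this needs q ≥ 2.
      have hdQ : d + 1 < q ^ (d + 1) := Nat.lt_pow_self hq1
      generalize q ^ (d + 1) = Q at *
      generalize RealRAM.phaseSize n q d ε = M at *
      have hQ : 1 ≤ Q := by omega
      have hnM : n ≤ M := le_trans (by nlinarith) hQM
      have hMn : 1 ≤ M * n := Nat.mul_pos hMp hn
      have b1 : M * n ≤ Q * (M * n) := Nat.le_mul_of_pos_left _ hQ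
      have b2 : Q ≤ Q * (M * n) := Nat.le_mul_of_pos_right _ hMn
      have b3 : n * n ≤ M * n := Nat.mul_le_mul_right n hnM
      have b4 : n ≤ M * n := Nat.le_mul_of_pos_left _ hMp
      have b5 : M ≤ M * n := Nat.le_mul_of_pos_right _ hn
      have b6 : d * (M * n) ≤ Q * (M * n) := Nat.mul_le_mul_right _ (by omega)
      nlinarith
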